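/- **Model.** Let $m,d,I_x,I_y,I_z,g>0$. The VTOL-UAV has state $x=(p_x,p_y,p_z,\phi,\theta,\psi,v_x,v_y,v_z,\Omega_x,\Omega_y,\Omega_z)\in\mathbb R^{12}$ (position, roll, pitch, yaw, velocity, body angular rates) and inputs $u_1$ (thrust), $u_2,u_3,u_4$ (torques), with $$\dot p=v,\quad \dot v=-g e_3+\tfrac{u_1}{m}R(\phi,\theta,\psi)e_3,$$ $$\dot\phi=\Omega_x+(\Omega_y\sin\phi+\Omega_z\cos\phi)\tan\theta,\quad \dot\theta=\Omega_y\cos\phi-\Omega_z\sin\phi,\quad \dot\psi=\frac{\Omega_y\sin\phi+\Omega_z\cos\phi}{\cos\theta},$$ $$\dot\Omega_x=\tfrac{I_y-I_z}{I_x}\Omega_y\Omega_z+\tfrac{d}{I_x}u_2,\quad \dot\Omega_y=\tfrac{I_z-I_x}{I_y}\Omega_x\Omega_z+\tfrac{d}{I_y}u_3,\quad \dot\Omega_z=\tfrac{I_x-I_y}{I_z}\Omega_x\Omega_y+\tfrac{d}{I_z}u_4,$$ where $R e_3=(\sin\phi\sin\psi+\cos\phi\cos\psi\sin\theta,\ \cos\phi\sin\psi\sin\theta-\cos\psi\sin\phi,\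 \cos\phi\cos\theta)^\top$. The thrust is passed through a double integrator, $u_1=\zeta$, $\ddot\zeta=\mathcal U_1$, and $\mathcal U_j=u_j$ for $j=2,3,4$. This gives a control-affine system $\dot{\bar x}=\bar f(\bar x)+\sum_j\bar g_j(\bar x)\,\mathcal U_j$ with state $\bar x=(x,\zeta,\dot\zeta)\in\mathbb R^{14}$ and outputs $h=(p_x,p_y,p_z,\psi)$. Put $r=(4,4,4,2)$, let $\bar A(\bar x)=(\mathcal L_{\bar g_j}\mathcal L_{\bar f}^{r_i-1}h_i(\bar x))_{ij}$ be the decoupling matrix, and let $\Phi(\bar x)=z\in\mathbb R^{14}$ consist of $\mathcal L_{\bar f}^{\rho}h_i$, $0\le\rho<r_i$, in the order $i=1,\dots,4$. Dynamic feedback linearization (DFL) applies $\mathcal U=\bar A(\bar x)^{-1}\big(v-(\mathcal L_{\bar f}^{r_i}h_i(\bar x))_i\big)$ with external input $v\in\mathbb R^4$. The linear equivalent model is $\dot z=A_zz+B_zv$ (three chains of four integrators and one chain of two). With sampling period $\delta>0$, put $A_d=I+\delta A_z$ and $B_d=\delta B_z$. **MPC-CBF problem.** Let $N\ge1$, $N_c\ge0$,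 $0<\gamma\le1$, $Q\succ0$, $R\succeq0$, let $\bar Q$ and $K$ be real matrices, and let the box bounds satisfy $\underline z<0<\overline z$ (on $z_1,z_5,z_9,z_{13}$) and $v_{\min}<0<v_{\max}$. For an obstacle with centre $(x_{\rm obs},y_{\rm obs},z_{\rm obs})$ and radius $r_{\rm obs}>0$ put $\mathcal H(z)=(z_1-x_{\rm obs})^2+(z_5-y_{\rm obs})^2+(z_9-z_{\rm obs})^2-r_{\rm obs}^2$. Let $$\mathcal Z_f(N_c)=\{z:\ v_{\min}\le K(A_d+B_dK)^iz\le v_{\max},\ \text{and components }1,5,9,13\text{ of }(A_d+B_dK)^iz\text{ lie in }[\underline z,\overline z],\ 0\le i\le N_c\}.$$ For a current state $z$, minimize $\sum_{i=0}^{N-1}(z_i^\top Qz_i+v_i^\top Rv_i)+z_N^\top\bar Qz_N$ over $v_0,\dots,v_{N-1}$, where $z_0=z$ and $z_{i+1}=A_dz_i+B_dv_i$, subject for $0\le i\le N-1$ to the output box on $z_i$, $v_{\min}\le v_i\le v_{\max}$, $\mathcal H(z_{i+1})-\mathcal H(z_i)\ge-\gamma\mathcal H(z_i)$, and to $z_N\in\mathcal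 Z_f(N_c)$. Let $J^*(z)$ be the optimal value. **Closed loop.** At each sampling instant $k$ the problem is solved for $z(k)=\Phi(\bar x(k))$, the first element $v(k)$ of a minimizer is passed to the DFL controller, and the DFL-controlled UAV is discretized by the forward Euler method in the coordinates $z$: $\Phi(\bar x(k+1))=\Phi(\bar x(k))+\delta\,D\Phi(\bar x(k))\big[\bar f+\sum_j\bar g_j\,\mathcal U_j\big](\bar x(k))$. Only trajectories are considered along which $\phi,\theta\in(-\pi/2,\pi/2)$ and $\bar A$ is nonsingular at all $k$. **Theorem.** Suppose that $K$ is stabilizing (all eigenvalues of $A_d+B_dK$ have modulus less than 1) and that $$\bar Q-(A_d+B_dK)^\top\bar Q(A_d+B_dK)=Q+K^\top RK .$$ Then $\sum_{i\ge0}(\|z(i)\|_Q^2+\|v(i)\|_R^2)=z(0)^\top\bar Qz(0)$ along $z(i+1)=(A_d+B_dK)z(i)$, $v(i)=Kz(i)$. Moreover, there is $N_0$ such that for all $N_c\ge N_0$ with $\mathcal H((A_d+B_dK)z)>(1-\gamma)\mathcal H(z)$ for all $z\in\mathcal Z_f(N_c)$ the following hold. 1. The problem has a minimizer whenever it is feasible.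 If it is feasible at $z$ and $v_0$ is the first element of a minimizer, then it is feasible at $z^+=A_dz+B_dv_0$, and $J^*(z^+)\le J^*(z)-(z^\top Qz+v_0^\top Rv_0)$. 2. For every closed-loop trajectory of the UAV for which the problem is feasible at $k=0$: the problem is feasible at every $k\ge0$; $J^*(z(k+1))\le J^*(z(k))-(\|z(k)\|_Q^2+\|v(k)\|_R^2)$ for every $k$; if the UAV is outside the obstacle at $k=0$ (i.e. $\mathcal H(z(0))\ge0$), then it is outside the obstacle at every $k$; and $\bar x(k)$ converges to the hover state $x=0$, $\zeta=mg$, $\dot\zeta=0$. 3. The hover state is Lyapunov stable for the closed loop: for every $\varepsilon>0$ there is $\eta>0$ such that every closed-loop trajectory starting within $\eta$ of it stays within $\varepsilon$ of it. -/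

import Mathlib

open Filter Topology
open scoped Matrix

noncomputable section

namespace VTOL

/-! ### The VTOL-UAV model -/

/-- Physical parameters: mass, arm length, principal inertias, gravity constant. -/
structure Params where
  m : ℝ
  d : ℝ
  Ix : ℝ
  Iy : ℝ
  Iz : ℝ
  grav : ℝ
  m_pos : 0 < m
  d_pos : 0 < d
  Ix_pos : 0 < Ix
  Iy_pos : 0 < Iy
  Iz_pos : 0 < Iz
  grav_pos : 0 < grav

/-- Rotation matrix of the Euler angles (roll `φ`, pitch `θ`, yaw `ψ`), body to inertial frame. -/
def rot (φ θ ψ : ℝ) : Matrix (Fin 3) (Fin 3) ℝ :=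
  !![Real.cos ψ * Real.cos θ,
      Real.cos ψ * Real.sin φ * Real.sin θ - Real.cos φ * Real.sin ψ,
      Real.sin φ * Real.sin ψ + Real.cos φ * Real.cos ψ * Real.sin θ;
    Real.cos θ * Real.sin ψ,
      Real.cos φ * Real.cos ψ + Real.sin φ * Real.sin ψ * Real.sin θ,
      Real.cos φ * Real.sin ψ * Real.sin θ - Real.cos ψ * Real.sin φ;
    -Real.sin θ, Real.cos θ * Real.sin φ, Real.cos φ * Real.cos θ]

/-- The state `(p_x, p_y, p_z, φ, θ, ψ, v_x, v_y, v_z, Ω_x, Ω_y, Ω_z)`: inertial position,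
Euler angles, inertial velocity, body angular rates. -/
abbrev State := Fin 12 → ℝ

/-- Drift field of the rigid body model. -/
def drift (p : Params) (x : State) : State :=
  ![x 6, x 7, x 8,
    x 9 + x 10 * Real.sin (x 3) * Real.tan (x 4) + x 11 * Real.cos (x 3) * Real.tan (x 4),
    x 10 * Real.cos (x 3) - x 11 * Real.sin (x 3),
    x 10 * Real.sin (x 3) / Real.cos (x 4) + x 11 * Real.cos (x 3) / Real.cos (x 4),
    0, 0, -p.grav,
    (p.Iy - p.Iz) / p.Ix * x 10 * x 11,
    (p.Iz - p.Ix) / p.Iy * x 9 * x 11,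
    (p.Ix - p.Iy) / p.Iz * x 9 * x 10]

/-- Input fields: total thrust along the third body axis, then the three torque inputs. -/
def inputField (p : Params) : Fin 4 → State → State :=
  ![fun x => ![0, 0, 0, 0, 0, 0,
      rot (x 3) (x 4) (x 5) 0 2 / p.m, rot (x 3) (x 4) (x 5) 1 2 / p.m,
      rot (x 3) (x 4) (x 5) 2 2 / p.m, 0, 0, 0],
    fun _ => ![0, 0, 0, 0, 0, 0, 0, 0, 0, p.d / p.Ix, 0, 0],
    fun _ => ![0, 0, 0, 0, 0, 0, 0, 0, 0, 0, p.d / p.Iy, 0],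
    fun _ => ![0, 0, 0, 0, 0, 0, 0, 0, 0, 0, 0, p.d / p.Iz]]

/-! ### Dynamic feedback linearization -/

/-- Extended state `(x, ζ, ξ)`: the thrust `ζ` is the output of a double integrator
`ζ' = ξ`, `ξ' = U₁`. -/
abbrev ExtState := State × ℝ × ℝ

def extDrift (p : Params) (X : ExtState) : ExtState :=
  (drift p X.1 + X.2.1 • inputField p 0 X.1, X.2.2, 0)

def extInputField (p : Params) (j : Fin 4) (X : ExtState) : ExtState :=
  if j = 0 then (0, 0, 1) else (inputField p j X.1, 0, 0)

/-- The outputs `p_x, p_y, p_z, ψ`. -/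
def output (i : Fin 4) (X : ExtState) : ℝ :=
  X.1 (![0, 1, 2, 5] i)

/-- Lie derivative of the function `l` along the vector field `f`. -/
def lieDeriv (f : ExtState → ExtState) (l : ExtState → ℝ) (X : ExtState) : ℝ :=
  fderiv ℝ l X (f X)

/-- `n`-fold Lie derivative of the `i`-th output along the extended drift. -/
def outLie (p : Params) (i : Fin 4) (n : ℕ) : ExtState → ℝ :=
  (lieDeriv (extDrift p))^[n] (output i)

/-- Vector relative degree of the extended system. -/
def relDeg : Fin 4 → ℕ := ![4, 4, 4, 2]

/-- Decoupling matrix of the extended system. -/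
def decoupling (p : Params) (X : ExtState) : Matrix (Fin 4) (Fin 4) ℝ :=
  Matrix.of fun i j => lieDeriv (extInputField p j) (outLie p i (relDeg i - 1)) X

/-- The linearizing feedback, with external input `v`. -/
def dfl (p : Params) (X : ExtState) (v : Fin 4 → ℝ) : Fin 4 → ℝ :=
  (decoupling p X)⁻¹ *ᵥ ((fun i => -outLie p i (relDeg i) X) + v)

/-- Right-hand side of the extended UAV dynamics under the linearizing feedback. -/
def dflField (p : Params) (X : ExtState) (v : Fin 4 → ℝ) : ExtState :=
  extDrift p X + ∑ j, dfl p X v j • extInputField p j X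

/-- The state mapping `z = Φ(x̄)`: each position coordinate with its first three time
derivatives, then the yaw angle with its first time derivative. -/
def stateMap (p : Params) (X : ExtState) : Fin 14 → ℝ :=
  ![outLie p 0 0 X, outLie p 0 1 X, outLie p 0 2 X, outLie p 0 3 X,
    outLie p 1 0 X, outLie p 1 1 X, outLie p 1 2 X, outLie p 1 3 X,
    outLie p 2 0 X, outLie p 2 1 X, outLie p 2 2 X, outLie p 2 3 X,
    outLie p 3 0 X, outLie p 3 1 X]

/-- Roll and pitch lie in `(-π/2, π/2)` and the decoupling matrix is nonsingular. -/
def Admissible (p : Params) (X : ExtState) : Prop :=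
  X.1 3 ∈ Set.Ioo (-(Real.pi / 2)) (Real.pi / 2) ∧
  X.1 4 ∈ Set.Ioo (-(Real.pi / 2)) (Real.pi / 2) ∧
  IsUnit (decoupling p X).det

/-- Hover at the origin: zero UAV state, thrust equal to the weight. -/
def hover (p : Params) : ExtState := (0, p.m * p.grav, 0)

/-! ### The linear equivalent model and its discretization -/

/-- Positions in `z` of the four outputs. -/
def outIdx : Fin 4 → Fin 14 := ![0, 4, 8, 12]

/-- Positions in `z` of the last entries of the four integrator chains. -/
def inIdx : Fin 4 → Fin 14 := ![3, 7, 11, 13]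

/-- Three chains of four integrators and one chain of two integrators. -/
def Az : Matrix (Fin 14) (Fin 14) ℝ :=
  Matrix.of fun i j => if j.val = i.val + 1 ∧ ∀ l, i ≠ inIdx l then 1 else 0

def Bz : Matrix (Fin 14) (Fin 4) ℝ :=
  Matrix.of fun i j => if i = inIdx j then 1 else 0

def Ad (δ : ℝ) : Matrix (Fin 14) (Fin 14) ℝ := 1 + δ • Az

def Bd (δ : ℝ) : Matrix (Fin 14) (Fin 4) ℝ := δ • Bz

/-! ### The MPC problem with discrete control barrier constraint -/

/-- Data of the MPC problem, except for the constraint checking horizon. -/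
structure MPC where
  /-- sampling period -/
  δ : ℝ
  /-- prediction horizon -/
  N : ℕ
  /-- state weight -/
  Q : Matrix (Fin 14) (Fin 14) ℝ
  /-- input weight -/
  R : Matrix (Fin 4) (Fin 4) ℝ
  /-- terminal weight -/
  Qbar : Matrix (Fin 14) (Fin 14) ℝ
  /-- terminal feedback gain -/
  K : Matrix (Fin 4) (Fin 14) ℝ
  /-- lower and upper bounds on the outputs -/
  zlo : Fin 4 → ℝ
  zhi : Fin 4 → ℝ
  /-- lower and upper bounds on the inputs -/
  vlo : Fin 4 → ℝ
  vhi : Fin 4 → ℝ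
  /-- centre and radius of the spherical obstacle -/
  obs : Fin 3 → ℝ
  rad : ℝ
  /-- decay parameter of the barrier constraint -/
  γ : ℝ

namespace MPC

variable (D : MPC)

/-- One step of the discretized linear equivalent model. -/
def step (z : Fin 14 → ℝ) (v : Fin 4 → ℝ) : Fin 14 → ℝ :=
  Ad D.δ *ᵥ z + Bd D.δ *ᵥ v

/-- The closed-loop matrix of the terminal feedback. -/
def Acl : Matrix (Fin 14) (Fin 14) ℝ := Ad D.δ + Bd D.δ * D.K

/-- The barrier function: squared distance to the obstacle centre minus squared radius. -/
def barrier (z : Fin 14 → ℝ) : ℝ :=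
  (z 0 - D.obs 0) ^ 2 + (z 4 - D.obs 1) ^ 2 + (z 8 - D.obs 2) ^ 2 - D.rad ^ 2

/-- Predicted states from `z` under the input sequence `v`. -/
def predict (z : Fin 14 → ℝ) (v : ℕ → Fin 4 → ℝ) : ℕ → Fin 14 → ℝ
  | 0 => z
  | i + 1 => D.step (predict z v i) (v i)

def OutputOK (z : Fin 14 → ℝ) : Prop :=
  ∀ l, D.zlo l ≤ z (outIdx l) ∧ z (outIdx l) ≤ D.zhi l

def InputOK (v : Fin 4 → ℝ) : Prop :=
  ∀ l, D.vlo l ≤ v l ∧ v l ≤ D.vhi l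

/-- Terminal set with constraint checking horizon `Nc`. -/
def terminalSet (Nc : ℕ) : Set (Fin 14 → ℝ) :=
  {z | ∀ i ≤ Nc, D.InputOK (D.K *ᵥ (D.Acl ^ i *ᵥ z)) ∧ D.OutputOK (D.Acl ^ i *ᵥ z)}

def stageCost (z : Fin 14 → ℝ) (v : Fin 4 → ℝ) : ℝ :=
  z ⬝ᵥ D.Q *ᵥ z + v ⬝ᵥ D.R *ᵥ v

/-- Finite-horizon cost; only the first `N` entries of `v` matter. -/
def cost (z : Fin 14 → ℝ) (v : ℕ → Fin 4 → ℝ) : ℝ :=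
  ∑ i ∈ Finset.range D.N, D.stageCost (D.predict z v i) (v i) +
    D.predict z v D.N ⬝ᵥ D.Qbar *ᵥ D.predict z v D.N

/-- The input sequence `v` satisfies all constraints of the problem with current state `z`. -/
def IsFeasible (Nc : ℕ) (z : Fin 14 → ℝ) (v : ℕ → Fin 4 → ℝ) : Prop :=
  (∀ i < D.N, D.OutputOK (D.predict z v i)) ∧
  (∀ i < D.N, D.InputOK (v i)) ∧
  (∀ i < D.N, D.barrier (D.predict z v (i + 1)) - D.barrier (D.predict z v i) ≥
    -D.γ * D.barrier (D.predict z v i)) ∧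
  D.predict z v D.N ∈ D.terminalSet Nc

/-- The problem with current state `z` is feasible. -/
def FeasibleAt (Nc : ℕ) (z : Fin 14 → ℝ) : Prop :=
  ∃ v, D.IsFeasible Nc z v

/-- `v` is a minimizer of the problem with current state `z`. -/
def IsOptimal (Nc : ℕ) (z : Fin 14 → ℝ) (v : ℕ → Fin 4 → ℝ) : Prop :=
  D.IsFeasible Nc z v ∧ ∀ v', D.IsFeasible Nc z v' → D.cost z v ≤ D.cost z v'

/-- Optimal cost `J*(z)`. -/
def optCost (Nc : ℕ) (z : Fin 14 → ℝ) : ℝ :=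
  sInf (D.cost z '' {v | D.IsFeasible Nc z v})

/-- The gain makes the terminal closed loop Schur stable. -/
def Stabilizing : Prop :=
  ∀ μ ∈ spectrum ℂ (D.Acl.map (algebraMap ℝ ℂ)), ‖μ‖ < 1

/-- The UAV is outside the (open) obstacle. -/
def AvoidsObstacle (X : ExtState) : Prop :=
  D.rad ^ 2 ≤ (X.1 0 - D.obs 0) ^ 2 + (X.1 1 - D.obs 1) ^ 2 + (X.1 2 - D.obs 2) ^ 2

/-- A closed-loop trajectory `X` of the UAV under the cascaded scheme. At every sampling instant
the measured state is mapped to `z = Φ(X k)`, a minimizer `w k` is computed if the problem is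
feasible (the input is arbitrary if it is not), and the first input `w k 0` is passed to
the linearizing feedback. The resulting UAV dynamics are discretized by the forward Euler method in
the coordinates `z`. Roll, pitch and the decoupling matrix satisfy the admissibility condition. -/
def ClosedLoop (p : Params) (Nc : ℕ) (X : ℕ → ExtState) (w : ℕ → ℕ → Fin 4 → ℝ) : Prop :=
  ∀ k, Admissible p (X k) ∧
    (D.FeasibleAt Nc (stateMap p (X k)) → D.IsOptimal Nc (stateMap p (X k)) (w k)) ∧
    stateMap p (X (k + 1)) = stateMap p (X k) +
      D.δ • fderiv ℝ (stateMap p) (X k) (dflField p (X k) (w k 0))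

end MPC

end VTOL

end

noncomputable section

namespace VTOL

/-! ### Powers of Schur stable matrices -/

section SchurStable

open scoped Matrix.Norms.Operator ENNReal NNReal

/-! The theorem splits into a linear MPC argument and an exact change of coordinates.

Linear side. The Lyapunov equation makes the terminal cost decrease along the terminal feedback by
exactly the stage cost. The terminal set, defined by finitely many checks, becomes invariant once
`Nc` is large: boxes on four consecutive outputs bound the state uniformly in `Nc`, and powers of
the Schur matrix push this bounded set into a neighbourhood of 0 where all constraints hold
(`MPC.exists_terminalSet_invariant`). Shifting an optimal input sequence and appending the terminal
feedback is then feasible, the assumed barrier inequality on the terminal set supplying the last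
barrier constraint (`MPC.IsFeasible.exists_shift`). Hence the optimal cost decreases. It dominates a
multiple of the squared norm, and on the terminal set, a neighbourhood of 0, it is at most the
terminal cost; this gives convergence and stability.

Nonlinear side. With the thrust behind two integrators, the inputs first appear in the fourth
position derivatives and the second yaw derivative, so the feedback turns the dynamics into
integrator chains (`fderiv_stateMap_dflField`). Euler steps in these coordinates are therefore steps
of the linear model. Conversely, on the admissible set a small `stateMap` forces the UAV to be near
hover (`tendsto_hover_of_tendsto_stateMap`): acceleration fixes thrust and tilt, jerk fixes thrust
rate and two body rates, and yaw rate fixes the third. -/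

theorem tendsto_pow_nhds_zero_of_spectralRadius_lt_one {A : Type*} [NormedRing A]
    [NormedAlgebra ℂ A] [CompleteSpace A] {a : A} (ha : spectralRadius ℂ a < 1) :
    Tendsto (fun n : ℕ => a ^ n) atTop (𝓝 0) := by
  obtain ⟨r, hr, hr1⟩ := ENNReal.lt_iff_exists_nnreal_btwn.1 ha
  -- Gelfand's formula: eventually `‖a ^ n‖ ^ (1 / n) < r`, which is geometric decay.
  have h := (spectrum.pow_nnnorm_pow_one_div_tendsto_nhds_spectralRadius a).eventually_lt_const hr
  have hr1' : (r : ℝ) < 1 := by exact_mod_cast hr1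
  refine squeeze_zero_norm' ?_ (tendsto_pow_atTop_nhds_zero_of_lt_one r.2 hr1')
  filter_upwards [h, eventually_gt_atTop 0] with n hn hn0
  have hn' : (0 : ℝ) < n := by exact_mod_cast hn0
  have h1 : ((‖a ^ n‖₊ : ℝ≥0∞) ^ (1 / n : ℝ)) ^ (n : ℝ) ≤ (r : ℝ≥0∞) ^ (n : ℝ) :=
    ENNReal.rpow_le_rpow hn.le hn'.le
  rw [← ENNReal.rpow_mul, one_div_mul_cancel hn'.ne', ENNReal.rpow_one, ENNReal.rpow_natCast] at h1
  exact_mod_cast h1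

/-- The eigenvalue condition lives over ℂ. Powers commute with the embedding of real matrices, and
taking real parts entrywise returns to ℝ. -/
theorem tendsto_pow_nhds_zero_of_schur {n : Type*} [Fintype n] [DecidableEq n] [Nonempty n]
    {A : Matrix n n ℝ} (hA : ∀ μ ∈ spectrum ℂ (A.map (algebraMap ℝ ℂ)), ‖μ‖ < 1) :
    Tendsto (fun k : ℕ => A ^ k) atTop (𝓝 0) := by
  have h1 : spectralRadius ℂ (A.map (algebraMap ℝ ℂ)) < 1 := by
    have := spectrum.spectralRadius_lt_of_forall_lt (A.map (algebraMap ℝ ℂ)) (r := 1)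
      (fun μ hμ => by exact_mod_cast hA μ hμ)
    simpa using this
  have h2 := tendsto_pow_nhds_zero_of_spectralRadius_lt_one h1
  have h3 : Tendsto (fun k : ℕ => ((A.map (algebraMap ℝ ℂ)) ^ k).map Complex.re) atTop
      (𝓝 ((0 : Matrix n n ℂ).map Complex.re)) :=
    ((continuous_id.matrix_map Complex.continuous_re).tendsto 0).comp h2
  have h4 : ∀ k : ℕ, ((A.map (algebraMap ℝ ℂ)) ^ k).map Complex.re = A ^ k := by
    intro k
    have h5 : (A.map (algebraMap ℝ ℂ)) ^ k = (A ^ k).map (algebraMap ℝ ℂ) :=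
      (map_pow (algebraMap ℝ ℂ).mapMatrix A k).symm
    rw [h5]
    ext i j
    simp
  simp only [h4] at h3
  convert h3 using 2
  ext i j
  simp

/-- Convergence in operator norm is uniform on bounded sets, so a single exponent serves a whole
terminal set. -/
theorem exists_forall_pow_mulVec_mem {n : Type*} [Fintype n] [DecidableEq n]
    {A : Matrix n n ℝ} (hA : Tendsto (fun k : ℕ => A ^ k) atTop (𝓝 0))
    {U : Set (n → ℝ)} (hU : U ∈ 𝓝 0) (M : ℝ) :
    ∃ k₀ : ℕ, ∀ k ≥ k₀, ∀ z : n → ℝ, ‖z‖ ≤ M → A ^ k *ᵥ z ∈ U := by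
  obtain ⟨r, hr, hrU⟩ := Metric.mem_nhds_iff.1 hU
  have hM : 0 < |M| + 1 := by positivity
  obtain ⟨k₀, hk₀⟩ := Metric.tendsto_atTop.1 hA (r / (|M| + 1)) (by positivity)
  refine ⟨k₀, fun k hk z hz => hrU ?_⟩
  have h1 := hk₀ k hk
  rw [dist_zero_right] at h1
  rw [mem_ball_zero_iff]
  calc ‖A ^ k *ᵥ z‖ ≤ ‖A ^ k‖ * ‖z‖ := Matrix.linfty_opNorm_mulVec _ _
    _ ≤ ‖A ^ k‖ * (|M| + 1) := by
        gcongr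
        linarith [le_abs_self M]
    _ < r / (|M| + 1) * (|M| + 1) := by gcongr
    _ = r := by field_simp

end SchurStable

theorem tendsto_pow_mulVec {n : Type*} [Fintype n] [DecidableEq n] {A : Matrix n n ℝ}
    (hA : Tendsto (fun k : ℕ => A ^ k) atTop (𝓝 0)) (z : n → ℝ) :
    Tendsto (fun k : ℕ => A ^ k *ᵥ z) atTop (𝓝 0) := by
  have h : Continuous fun B : Matrix n n ℝ => B *ᵥ z := continuous_id.matrix_mulVec continuous_const
  simpa [Function.comp_def] using (h.tendsto 0).comp hA

/-! ### Quadratic forms -/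

theorem continuous_quadForm {n : Type*} [Fintype n] (A : Matrix n n ℝ) :
    Continuous fun z : n → ℝ => z ⬝ᵥ A *ᵥ z :=
  continuous_id.dotProduct (continuous_const.matrix_mulVec continuous_id)

/-- The constant is the minimum of the form on the compact unit sphere, extended by homogeneity. -/
theorem exists_pos_mul_sq_norm_le_quadForm {n : Type*} [Fintype n] {A : Matrix n n ℝ}
    (hA : A.PosDef) : ∃ c > 0, ∀ z : n → ℝ, c * ‖z‖ ^ 2 ≤ z ⬝ᵥ A *ᵥ z := by
  rcases isEmpty_or_nonempty n with hn | hn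
  · exact ⟨1, one_pos, fun z => by simp [Subsingleton.elim z 0]⟩
  obtain ⟨y, hy, hmin⟩ := (isCompact_sphere (0 : n → ℝ) 1).exists_isMinOn
    (NormedSpace.sphere_nonempty.2 zero_le_one) (continuous_quadForm A).continuousOn
  have hy1 : ‖y‖ = 1 := by simpa using hy
  refine ⟨y ⬝ᵥ A *ᵥ y, ?_, fun z => ?_⟩
  · have := hA.dotProduct_mulVec_pos (x := y) (by rintro rfl; simp at hy1)
    simpa using this
  · rcases eq_or_ne z 0 with rfl | hz
    · simp
    have hz' : ‖z‖ ≠ 0 := norm_ne_zero_iff.2 hz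
    have h1 := hmin (show ‖z‖⁻¹ • z ∈ Metric.sphere (0 : n → ℝ) 1 by simp [norm_smul, hz'])
    simp only [Set.mem_ofPred_eq, Matrix.mulVec_smul, dotProduct_smul, smul_dotProduct,
      smul_eq_mul] at h1
    calc _ ≤ (‖z‖⁻¹ * (‖z‖⁻¹ * (z ⬝ᵥ A *ᵥ z))) * ‖z‖ ^ 2 := by gcongr
      _ = _ := by field_simp

/-! ### The discretized linear equivalent model in coordinates -/

theorem Az_mulVec_of_succ (z : Fin 14 → ℝ) {i k : Fin 14}
    (h : ∀ j : Fin 14, (j.val = i.val + 1 ∧ ∀ l, i ≠ inIdx l) ↔ j = k) : (Az *ᵥ z) i = z k := by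
  simp [Matrix.mulVec, dotProduct, Az, h]

theorem Az_mulVec_inIdx (z : Fin 14 → ℝ) (l : Fin 4) : (Az *ᵥ z) (inIdx l) = 0 := by
  simp only [Matrix.mulVec, dotProduct, Az, Matrix.of_apply]
  exact Finset.sum_eq_zero fun j _ => by rw [if_neg fun h => h.2 l rfl, zero_mul]

theorem Bz_mulVec_inIdx (v : Fin 4 → ℝ) (l : Fin 4) : (Bz *ᵥ v) (inIdx l) = v l := by
  have h : ∀ j : Fin 4, inIdx l = inIdx j ↔ j = l := by revert l; decide
  simp [Matrix.mulVec, dotProduct, Bz, h]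

theorem Bz_mulVec_of_ne (v : Fin 4 → ℝ) {i : Fin 14} (h : ∀ l, i ≠ inIdx l) :
    (Bz *ᵥ v) i = 0 := by
  simp [Matrix.mulVec, dotProduct, Bz, h]

theorem Az_mulVec_add_Bz_mulVec (z : Fin 14 → ℝ) (v : Fin 4 → ℝ) :
    Az *ᵥ z + Bz *ᵥ v =
      ![z 1, z 2, z 3, v 0, z 5, z 6, z 7, v 1, z 9, z 10, z 11, v 2, z 13, v 3] := by
  have hs : ∀ {i k : Fin 14}, (∀ j : Fin 14, (j.val = i.val + 1 ∧ ∀ l, i ≠ inIdx l) ↔ j = k) →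
      (Az *ᵥ z + Bz *ᵥ v) i = z k := fun h => by
    rw [Pi.add_apply, Az_mulVec_of_succ z h, Bz_mulVec_of_ne v ((h _).2 rfl).2, add_zero]
  have hi : ∀ l, (Az *ᵥ z + Bz *ᵥ v) (inIdx l) = v l := fun l => by
    rw [Pi.add_apply, Az_mulVec_inIdx, Bz_mulVec_inIdx, zero_add]
  ext i
  fin_cases i
  exacts [hs (by decide), hs (by decide), hs (by decide), hi 0, hs (by decide), hs (by decide),
    hs (by decide), hi 1, hs (by decide), hs (by decide), hs (by decide), hi 2, hs (by decide), hi 3]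

namespace MPC

variable (D : MPC)

theorem step_eq (z : Fin 14 → ℝ) (v : Fin 4 → ℝ) :
    D.step z v = z + D.δ • (Az *ᵥ z + Bz *ᵥ v) := by
  simp only [step, Ad, Bd, Matrix.add_mulVec, Matrix.one_mulVec, Matrix.smul_mulVec, smul_add]
  abel

theorem Acl_mulVec (z : Fin 14 → ℝ) : D.Acl *ᵥ z = D.step z (D.K *ᵥ z) := by
  simp only [step, Acl, Matrix.add_mulVec, Matrix.mulVec_mulVec]

theorem Acl_pow_succ_mulVec (z : Fin 14 → ℝ) (i : ℕ) :
    D.Acl ^ (i + 1) *ᵥ z = D.Acl ^ i *ᵥ z +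
      D.δ • (Az *ᵥ (D.Acl ^ i *ᵥ z) + Bz *ᵥ (D.K *ᵥ (D.Acl ^ i *ᵥ z))) := by
  rw [pow_succ', ← Matrix.mulVec_mulVec, Acl_mulVec, step_eq]

end MPC


namespace MPC

variable (D : MPC)

/-! ### Terminal cost and terminal set -/

/-- This is the Lyapunov equation evaluated as a quadratic form at `z`. -/
theorem terminal_cost_Acl (hLyap : D.Qbar - D.Aclᵀ * D.Qbar * D.Acl = D.Q + D.Kᵀ * D.R * D.K)
    (z : Fin 14 → ℝ) :
    (D.Acl *ᵥ z) ⬝ᵥ D.Qbar *ᵥ (D.Acl *ᵥ z) =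
      z ⬝ᵥ D.Qbar *ᵥ z - D.stageCost z (D.K *ᵥ z) := by
  have hconj : ∀ {k : ℕ} (B : Matrix (Fin k) (Fin 14) ℝ) (C : Matrix (Fin k) (Fin k) ℝ),
      z ⬝ᵥ (Bᵀ * C * B) *ᵥ z = (B *ᵥ z) ⬝ᵥ C *ᵥ (B *ᵥ z) := by
    intro k B C
    rw [Matrix.mul_assoc, ← Matrix.mulVec_mulVec, ← Matrix.mulVec_mulVec, Matrix.dotProduct_mulVec,
      Matrix.vecMul_transpose]
  have h := congrArg (fun M => z ⬝ᵥ M *ᵥ z) hLyap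
  simp only [Matrix.sub_mulVec, Matrix.add_mulVec, dotProduct_sub, dotProduct_add, hconj] at h
  rw [stageCost]
  linarith

theorem stageCost_nonneg (hQ : D.Q.PosDef) (hR : D.R.PosSemidef) (z : Fin 14 → ℝ)
    (v : Fin 4 → ℝ) : 0 ≤ D.stageCost z v := by
  have h1 := hQ.posSemidef.dotProduct_mulVec_nonneg z
  have h2 := hR.dotProduct_mulVec_nonneg v
  simp only [star_trivial] at h1 h2
  exact add_nonneg h1 h2

/-- Partial sums telescope by `terminal_cost_Acl`; the remaining terminal term vanishes because the
powers of `Acl` tend to 0. -/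
theorem hasSum_stageCost (hQ : D.Q.PosDef) (hR : D.R.PosSemidef) (hK : D.Stabilizing)
    (hLyap : D.Qbar - D.Aclᵀ * D.Qbar * D.Acl = D.Q + D.Kᵀ * D.R * D.K) (z : Fin 14 → ℝ) :
    HasSum (fun i : ℕ => D.stageCost (D.Acl ^ i *ᵥ z) (D.K *ᵥ (D.Acl ^ i *ᵥ z)))
      (z ⬝ᵥ D.Qbar *ᵥ z) := by
  rw [hasSum_iff_tendsto_nat_of_nonneg fun i => D.stageCost_nonneg hQ hR _ _]
  have hsum : ∀ n : ℕ,
      ∑ i ∈ Finset.range n, D.stageCost (D.Acl ^ i *ᵥ z) (D.K *ᵥ (D.Acl ^ i *ᵥ z)) =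
        z ⬝ᵥ D.Qbar *ᵥ z - (D.Acl ^ n *ᵥ z) ⬝ᵥ D.Qbar *ᵥ (D.Acl ^ n *ᵥ z) := by
    intro n
    induction n with
    | zero => simp
    | succ n ih =>
      rw [Finset.sum_range_succ, ih, pow_succ', ← Matrix.mulVec_mulVec,
        D.terminal_cost_Acl hLyap (D.Acl ^ n *ᵥ z)]
      ring
  simp only [hsum]
  have h := ((continuous_quadForm D.Qbar).tendsto 0).comp
    (tendsto_pow_mulVec (tendsto_pow_nhds_zero_of_schur hK) z)
  simpa [Function.comp_def] using (tendsto_const_nhds (x := z ⬝ᵥ D.Qbar *ᵥ z)).sub h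

theorem terminal_cost_nonneg (hQ : D.Q.PosDef) (hR : D.R.PosSemidef) (hK : D.Stabilizing)
    (hLyap : D.Qbar - D.Aclᵀ * D.Qbar * D.Acl = D.Q + D.Kᵀ * D.R * D.K) (z : Fin 14 → ℝ) :
    0 ≤ z ⬝ᵥ D.Qbar *ᵥ z :=
  (D.hasSum_stageCost hQ hR hK hLyap z).nonneg fun _ => D.stageCost_nonneg hQ hR _ _

/-- A bounded integrator has bounded increments, hence bounded input. The bound on `b` covers one
time step fewer than that on `a`. -/
theorem abs_le_of_integrator {δ c : ℝ} (hδ : 0 < δ) {a b : ℕ → ℝ} {n : ℕ}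
    (hab : ∀ i, a (i + 1) = a i + δ * b i) (ha : ∀ i ≤ n + 1, |a i| ≤ c) :
    ∀ i ≤ n, |b i| ≤ 2 * c / δ := by
  intro i hi
  have h1 := abs_le.1 (ha i (by omega))
  have h2 := abs_le.1 (ha (i + 1) (by omega))
  have h3 := hab i
  rw [abs_le, ← neg_div, div_le_iff₀ hδ, le_div_iff₀ hδ]
  constructor <;> linarith

/-- The output trajectory over four steps determines the state: the terminal sets are bounded. -/
theorem exists_norm_le_of_mem_terminalSet (hδ : 0 < D.δ) :
    ∃ M, ∀ Nc ≥ 3, ∀ z ∈ D.terminalSet Nc, ‖z‖ ≤ M := by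
  obtain ⟨c, hc⟩ : ∃ c, ∀ l, ∀ y, D.zlo l ≤ y → y ≤ D.zhi l → |y| ≤ c := by
    refine ⟨∑ l, (|D.zlo l| + |D.zhi l|), fun l y h1 h2 => ?_⟩
    refine le_trans ?_ (Finset.single_le_sum (f := fun l => |D.zlo l| + |D.zhi l|)
      (fun l _ => by positivity) (Finset.mem_univ l))
    rw [abs_le]
    constructor <;> linarith [neg_abs_le (D.zlo l), le_abs_self (D.zhi l), abs_nonneg (D.zlo l),
      abs_nonneg (D.zhi l)]
  set c1 := 2 * c / D.δ with hc1
  set c2 := 2 * c1 / D.δ with hc2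
  set c3 := 2 * c2 / D.δ with hc3
  -- Each differentiation along a chain loses one time step. Outputs at times 0 to 3 thus reach the
  -- fourth entry of a chain at time 0, which is why `Nc ≥ 3` suffices.
  refine ⟨max (max |c| |c1|) (max |c2| |c3|), fun Nc hNc z hz => ?_⟩
  have hsucc : ∀ i, D.Acl ^ (i + 1) *ᵥ z = _ := fun i => D.Acl_pow_succ_mulVec z i
  simp only [Az_mulVec_add_Bz_mulVec] at hsucc
  have hout : ∀ l, ∀ i ≤ 3, |(D.Acl ^ i *ᵥ z) (outIdx l)| ≤ c := fun l i hi =>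
    hc l _ ((hz i (hi.trans hNc)).2 l).1 ((hz i (hi.trans hNc)).2 l).2
  have e0 : D.Acl ^ 0 *ᵥ z = z := by simp
  have chain : ∀ (j k : Fin 14) (n : ℕ) (C : ℝ),
      (∀ i, (D.Acl ^ (i + 1) *ᵥ z) j = (D.Acl ^ i *ᵥ z) j + D.δ * (D.Acl ^ i *ᵥ z) k) →
      (∀ i ≤ n + 1, |(D.Acl ^ i *ᵥ z) j| ≤ C) →
      ∀ i ≤ n, |(D.Acl ^ i *ᵥ z) k| ≤ 2 * C / D.δ := fun j k n C h1 h2 =>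
    abs_le_of_integrator hδ h1 h2
  have b0 := hout 0
  have b1 := chain 0 1 2 c (fun i => by rw [hsucc]; rfl) b0
  have b2 := chain 1 2 1 c1 (fun i => by rw [hsucc]; rfl) b1
  have b3 := chain 2 3 0 c2 (fun i => by rw [hsucc]; rfl) b2
  have b4 := hout 1
  have b5 := chain 4 5 2 c (fun i => by rw [hsucc]; rfl) b4
  have b6 := chain 5 6 1 c1 (fun i => by rw [hsucc]; rfl) b5
  have b7 := chain 6 7 0 c2 (fun i => by rw [hsucc]; rfl) b6
  have b8 := hout 2
  have b9 := chain 8 9 2 c (fun i => by rw [hsucc]; rfl) b8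
  have b10 := chain 9 10 1 c1 (fun i => by rw [hsucc]; rfl) b9
  have b11 := chain 10 11 0 c2 (fun i => by rw [hsucc]; rfl) b10
  have b12 := hout 3
  have b13 := chain 12 13 2 c (fun i => by rw [hsucc]; rfl) b12
  have m0 : ∀ {y : ℝ}, |y| ≤ c → ‖y‖ ≤ max (max |c| |c1|) (max |c2| |c3|) := fun h =>
    (h.trans (le_abs_self c)).trans ((le_max_left _ _).trans (le_max_left _ _))
  have m1 : ∀ {y : ℝ}, |y| ≤ c1 → ‖y‖ ≤ max (max |c| |c1|) (max |c2| |c3|) := fun h =>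
    (h.trans (le_abs_self c1)).trans ((le_max_right _ _).trans (le_max_left _ _))
  have m2 : ∀ {y : ℝ}, |y| ≤ c2 → ‖y‖ ≤ max (max |c| |c1|) (max |c2| |c3|) := fun h =>
    (h.trans (le_abs_self c2)).trans ((le_max_left _ _).trans (le_max_right _ _))
  have m3 : ∀ {y : ℝ}, |y| ≤ c3 → ‖y‖ ≤ max (max |c| |c1|) (max |c2| |c3|) := fun h =>
    (h.trans (le_abs_self c3)).trans ((le_max_right _ _).trans (le_max_right _ _))
  rw [pi_norm_le_iff_of_nonneg (le_max_of_le_left (le_max_of_le_left (abs_nonneg c)))]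
  rw [← e0]
  intro i
  fin_cases i
  exacts [m0 (b0 0 (by omega)), m1 (b1 0 (by omega)), m2 (b2 0 (by omega)), m3 (b3 0 le_rfl),
    m0 (b4 0 (by omega)), m1 (b5 0 (by omega)), m2 (b6 0 (by omega)), m3 (b7 0 le_rfl),
    m0 (b8 0 (by omega)), m1 (b9 0 (by omega)), m2 (b10 0 (by omega)), m3 (b11 0 le_rfl),
    m0 (b12 0 (by omega)), m1 (b13 0 (by omega))]

theorem setOf_constraints_mem_nhds (hz : ∀ l, D.zlo l < 0 ∧ 0 < D.zhi l)
    (hv : ∀ l, D.vlo l < 0 ∧ 0 < D.vhi l) :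
    {z : Fin 14 → ℝ | D.InputOK (D.K *ᵥ z) ∧ D.OutputOK z} ∈ 𝓝 0 := by
  have hKc : Continuous fun z : Fin 14 → ℝ => D.K *ᵥ z :=
    continuous_const.matrix_mulVec continuous_id
  have h1 : ∀ l, ∀ᶠ z : Fin 14 → ℝ in 𝓝 0, D.vlo l ≤ (D.K *ᵥ z) l ∧ (D.K *ᵥ z) l ≤ D.vhi l := by
    intro l
    have h : Tendsto (fun z : Fin 14 → ℝ => (D.K *ᵥ z) l) (𝓝 0) (𝓝 0) := by
      simpa [Function.comp_def] using ((continuous_apply l).comp hKc).tendsto 0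
    exact h.eventually (Icc_mem_nhds (hv l).1 (hv l).2)
  have h2 : ∀ l, ∀ᶠ z : Fin 14 → ℝ in 𝓝 0, D.zlo l ≤ z (outIdx l) ∧ z (outIdx l) ≤ D.zhi l := by
    intro l
    have h : Tendsto (fun z : Fin 14 → ℝ => z (outIdx l)) (𝓝 0) (𝓝 0) :=
      (continuous_apply (outIdx l)).tendsto 0
    exact h.eventually (Icc_mem_nhds (hz l).1 (hz l).2)
  exact (eventually_all.2 h1).and (eventually_all.2 h2)

/-- Passing from `z` to `Acl *ᵥ z` adds only the check at index `Nc + 1`. That check is automatic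
once the powers send the ball of radius `M` into the constraint neighbourhood. Since `M` does not
depend on `Nc`, the choice of threshold is not circular. -/
theorem exists_terminalSet_invariant (hδ : 0 < D.δ) (hz : ∀ l, D.zlo l < 0 ∧ 0 < D.zhi l)
    (hv : ∀ l, D.vlo l < 0 ∧ 0 < D.vhi l) (hK : D.Stabilizing) :
    ∃ N₀, ∀ Nc ≥ N₀, ∀ z ∈ D.terminalSet Nc, D.Acl *ᵥ z ∈ D.terminalSet Nc := by
  obtain ⟨M, hM⟩ := D.exists_norm_le_of_mem_terminalSet hδ
  obtain ⟨k₀, hk₀⟩ := exists_forall_pow_mulVec_mem (tendsto_pow_nhds_zero_of_schur hK)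
    (D.setOf_constraints_mem_nhds hz hv) M
  refine ⟨max 3 k₀, fun Nc hNc z hzt i hi => ?_⟩
  rw [show D.Acl ^ i *ᵥ D.Acl *ᵥ z = D.Acl ^ (i + 1) *ᵥ z by rw [Matrix.mulVec_mulVec, pow_succ]]
  rcases hi.lt_or_eq with hi | rfl
  · exact hzt (i + 1) hi
  · exact hk₀ _ (le_trans (le_of_max_le_right hNc) (Nat.le_succ _)) z
      (hM _ (le_of_max_le_left hNc) z hzt)

theorem isClosed_setOf_inputOK : IsClosed {v | D.InputOK v} := by
  simp only [InputOK, Set.ofPred_forall]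
  exact isClosed_iInter fun l => (isClosed_le continuous_const (continuous_apply l)).inter
    (isClosed_le (continuous_apply l) continuous_const)

theorem isClosed_setOf_outputOK : IsClosed {z | D.OutputOK z} := by
  simp only [OutputOK, Set.ofPred_forall]
  exact isClosed_iInter fun l => (isClosed_le continuous_const (continuous_apply (outIdx l))).inter
    (isClosed_le (continuous_apply (outIdx l)) continuous_const)

theorem isClosed_terminalSet (Nc : ℕ) : IsClosed (D.terminalSet Nc) := by
  simp only [terminalSet, Set.ofPred_forall]
  refine isClosed_iInter fun i => isClosed_iInter fun _ => ?_
  have h : Continuous fun z : Fin 14 → ℝ => D.Acl ^ i *ᵥ z :=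
    continuous_const.matrix_mulVec continuous_id
  exact (D.isClosed_setOf_inputOK.preimage (continuous_const.matrix_mulVec h)).inter
    (D.isClosed_setOf_outputOK.preimage h)

theorem terminalSet_mem_nhds (hz : ∀ l, D.zlo l < 0 ∧ 0 < D.zhi l)
    (hv : ∀ l, D.vlo l < 0 ∧ 0 < D.vhi l) (Nc : ℕ) : D.terminalSet Nc ∈ 𝓝 0 := by
  have h : ∀ i ∈ Finset.range (Nc + 1), ∀ᶠ z : Fin 14 → ℝ in 𝓝 0,
      D.InputOK (D.K *ᵥ (D.Acl ^ i *ᵥ z)) ∧ D.OutputOK (D.Acl ^ i *ᵥ z) := by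
    intro i _
    have h : Tendsto (fun z : Fin 14 → ℝ => D.Acl ^ i *ᵥ z) (𝓝 0) (𝓝 0) := by
      have h' : Continuous fun z : Fin 14 → ℝ => D.Acl ^ i *ᵥ z :=
        continuous_const.matrix_mulVec continuous_id
      simpa using h'.tendsto 0
    exact h.eventually (D.setOf_constraints_mem_nhds hz hv)
  filter_upwards [(eventually_all_finset _).2 h] with z hz i hi
  exact hz i (Finset.mem_range.2 (Nat.lt_succ_of_le hi))

/-! ### The optimization problem -/

theorem predict_congr {z : Fin 14 → ℝ} {v v' : ℕ → Fin 4 → ℝ} {i : ℕ}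
    (h : ∀ j < i, v j = v' j) : D.predict z v i = D.predict z v' i := by
  induction i with
  | zero => rfl
  | succ i ih =>
    rw [predict, predict, ih fun j hj => h j (hj.trans i.lt_succ_self), h i i.lt_succ_self]

theorem predict_step (z : Fin 14 → ℝ) (v : ℕ → Fin 4 → ℝ) (i : ℕ) :
    D.predict (D.step z (v 0)) (fun j => v (j + 1)) i = D.predict z v (i + 1) := by
  induction i with
  | zero => rfl
  | succ i ih => rw [predict, ih]; rfl

theorem cost_congr {z : Fin 14 → ℝ} {v v' : ℕ → Fin 4 → ℝ} (h : ∀ j < D.N, v j = v' j) :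
    D.cost z v = D.cost z v' := by
  rw [cost, cost, D.predict_congr h]
  congr 1
  refine Finset.sum_congr rfl fun i hi => ?_
  have hi := Finset.mem_range.1 hi
  rw [h i hi, D.predict_congr fun j hj => h j (hj.trans hi)]

theorem IsFeasible.congr {D : MPC} {Nc : ℕ} {z : Fin 14 → ℝ} {v v' : ℕ → Fin 4 → ℝ}
    (hv : D.IsFeasible Nc z v) (h : ∀ j < D.N, v j = v' j) : D.IsFeasible Nc z v' := by
  have hp : ∀ i ≤ D.N, D.predict z v i = D.predict z v' i := fun i hi =>
    D.predict_congr fun j hj => h j (hj.trans_le hi)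
  obtain ⟨h1, h2, h3, h4⟩ := hv
  refine ⟨fun i hi => hp i hi.le ▸ h1 i hi, fun i hi => h i hi ▸ h2 i hi, fun i hi => ?_,
    hp _ le_rfl ▸ h4⟩
  rw [← hp i hi.le, ← hp (i + 1) hi]
  exact h3 i hi

theorem continuous_step : Continuous fun x : (Fin 14 → ℝ) × (Fin 4 → ℝ) => D.step x.1 x.2 :=
  (continuous_const.matrix_mulVec continuous_fst).add
    (continuous_const.matrix_mulVec continuous_snd)

theorem continuous_predict (z : Fin 14 → ℝ) (i : ℕ) : Continuous fun v => D.predict z v i := by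
  induction i with
  | zero => exact continuous_const
  | succ i ih => exact D.continuous_step.comp (ih.prodMk (continuous_apply i))

theorem continuous_barrier : Continuous D.barrier := by
  unfold barrier
  fun_prop

theorem continuous_cost (z : Fin 14 → ℝ) : Continuous (D.cost z) := by
  unfold cost stageCost
  refine (continuous_finsetSum _ fun i _ => ?_).add
    ((continuous_quadForm _).comp (D.continuous_predict z _))
  exact ((continuous_quadForm _).comp (D.continuous_predict z _)).add
    ((continuous_quadForm _).comp (continuous_apply i))

theorem isClosed_setOf_isFeasible (Nc : ℕ) (z : Fin 14 → ℝ) :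
    IsClosed {v | D.IsFeasible Nc z v} := by
  simp only [IsFeasible, Set.ofPred_and, Set.ofPred_forall]
  have hp := D.continuous_predict z
  refine IsClosed.inter ?_ (IsClosed.inter ?_ (IsClosed.inter ?_ ?_))
  · exact isClosed_iInter fun i => isClosed_iInter fun _ =>
      D.isClosed_setOf_outputOK.preimage (hp i)
  · exact isClosed_iInter fun i => isClosed_iInter fun _ =>
      D.isClosed_setOf_inputOK.preimage (continuous_apply (A := fun _ : ℕ => Fin 4 → ℝ) i)
  · exact isClosed_iInter fun i => isClosed_iInter fun _ =>
      isClosed_le (continuous_const.mul (D.continuous_barrier.comp (hp i)))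
        ((D.continuous_barrier.comp (hp (i + 1))).sub (D.continuous_barrier.comp (hp i)))
  · exact (D.isClosed_terminalSet Nc).preimage (hp D.N)

/-- Input sequences are infinite and unconstrained from index `N` on, so the feasible set itself
need not be compact. Replacing the irrelevant tail by 0, which lies in the input box, changes
neither feasibility nor cost and lands in a Tychonoff-compact product of boxes. -/
theorem exists_isOptimal (hv : ∀ l, D.vlo l < 0 ∧ 0 < D.vhi l) {Nc : ℕ} {z : Fin 14 → ℝ}
    (h : D.FeasibleAt Nc z) : ∃ v, D.IsOptimal Nc z v := by
  classical
  set box : Set (ℕ → Fin 4 → ℝ) :=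
    Set.pi Set.univ fun _ => Set.pi Set.univ fun l => Set.Icc (D.vlo l) (D.vhi l) with hbox
  have hcomp : IsCompact ({v | D.IsFeasible Nc z v} ∩ box) :=
    (isCompact_univ_pi fun _ => isCompact_univ_pi fun _ => isCompact_Icc).inter_left
      (D.isClosed_setOf_isFeasible Nc z)
  have htrunc : ∀ v, D.IsFeasible Nc z v →
      ∃ v' ∈ {v | D.IsFeasible Nc z v} ∩ box, D.cost z v' = D.cost z v := by
    intro v hfeas
    have hv' : ∀ j < D.N, v j = (fun j => if j < D.N then v j else 0) j := fun j hj => by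
      simp [hj]
    refine ⟨_, ⟨hfeas.congr hv', ?_⟩, (D.cost_congr hv').symm⟩
    intro j _ l _
    by_cases hj : j < D.N
    · simp only [hj, if_true]
      exact hfeas.2.1 j hj l
    · simp only [hj, if_false]
      exact ⟨(hv l).1.le, (hv l).2.le⟩
  obtain ⟨v, hfeas⟩ := h
  obtain ⟨v', hv', -⟩ := htrunc v hfeas
  obtain ⟨u, hu, hmin⟩ := hcomp.exists_isMinOn ⟨v', hv'⟩ (D.continuous_cost z).continuousOn
  refine ⟨u, hu.1, fun y hy => ?_⟩
  obtain ⟨y', hy', he⟩ := htrunc y hy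
  exact he ▸ hmin hy'

theorem IsOptimal.optCost_eq {D : MPC} {Nc : ℕ} {z : Fin 14 → ℝ} {v : ℕ → Fin 4 → ℝ}
    (h : D.IsOptimal Nc z v) : D.optCost Nc z = D.cost z v := by
  refine IsLeast.csInf_eq ⟨⟨v, h.1, rfl⟩, ?_⟩
  rintro _ ⟨v', hv', rfl⟩
  exact h.2 v' hv'

theorem optCost_le (hv : ∀ l, D.vlo l < 0 ∧ 0 < D.vhi l) {Nc : ℕ} {z : Fin 14 → ℝ}
    {v : ℕ → Fin 4 → ℝ} (h : D.IsFeasible Nc z v) : D.optCost Nc z ≤ D.cost z v := by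
  obtain ⟨u, hu⟩ := D.exists_isOptimal hv ⟨v, h⟩
  exact hu.optCost_eq ▸ hu.2 v h

/-- Shifting a feasible input sequence and appending the terminal feedback yields a feasible
sequence for the successor state. -/
theorem IsFeasible.exists_shift {D : MPC} (hN : 1 ≤ D.N) {Nc : ℕ}
    (hLyap : D.Qbar - D.Aclᵀ * D.Qbar * D.Acl = D.Q + D.Kᵀ * D.R * D.K)
    (hinv : ∀ z ∈ D.terminalSet Nc, D.Acl *ᵥ z ∈ D.terminalSet Nc)
    (hbar : ∀ z ∈ D.terminalSet Nc, D.barrier (D.Acl *ᵥ z) > (1 - D.γ) * D.barrier z)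
    {z : Fin 14 → ℝ} {v : ℕ → Fin 4 → ℝ} (h : D.IsFeasible Nc z v) :
    ∃ v', D.IsFeasible Nc (D.step z (v 0)) v' ∧
      D.cost (D.step z (v 0)) v' = D.cost z v - D.stageCost z (v 0) := by
  obtain ⟨n, hn⟩ : ∃ n, D.N = n + 1 := ⟨D.N - 1, by omega⟩
  obtain ⟨h1, h2, h3, h4⟩ := h
  set y := D.predict z v D.N with hy
  set v' : ℕ → Fin 4 → ℝ := fun i => if i < n then v (i + 1) else D.K *ᵥ y with hv'
  have hpre : ∀ i ≤ n, D.predict (D.step z (v 0)) v' i = D.predict z v (i + 1) := by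
    intro i hi
    rw [← D.predict_step]
    exact D.predict_congr fun j hj => if_pos (hj.trans_le hi)
  have hlast : D.predict (D.step z (v 0)) v' (n + 1) = D.Acl *ᵥ y := by
    rw [predict, hpre n le_rfl, ← hn, ← hy, Acl_mulVec]
    simp [hv']
  have hpren : D.predict (D.step z (v 0)) v' n = y := by rw [hpre n le_rfl, hy, hn]
  have hv'n : v' n = D.K *ᵥ y := by simp [hv']
  -- Index 0 of the terminal set gives the output box at time `N`, which the problem does not impose
  -- directly, and the input bounds for the appended feedback.
  have hterm := h4 0 (Nat.zero_le _)
  rw [pow_zero, Matrix.one_mulVec] at hterm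
  refine ⟨v', ⟨fun i hi => ?_, fun i hi => ?_, fun i hi => ?_, ?_⟩, ?_⟩
  · rcases (Nat.lt_succ_iff.1 (hn ▸ hi)).lt_or_eq with hi | rfl
    · rw [hpre i hi.le]
      exact h1 _ (by omega)
    · rw [hpren]
      exact hterm.2
  · rcases (Nat.lt_succ_iff.1 (hn ▸ hi)).lt_or_eq with hi | rfl
    · simp only [hv', if_pos hi]
      exact h2 _ (by omega)
    · rw [hv'n]
      exact hterm.1
  · rcases (Nat.lt_succ_iff.1 (hn ▸ hi)).lt_or_eq with hi | rfl
    · rw [hpre i hi.le, hpre (i + 1) hi]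
      exact h3 _ (by omega)
    · rw [hpren, hlast]
      linarith [hbar y h4]
  · rw [hn, hlast]
    exact hinv y h4
  · rw [cost, cost, ← hy, hn, hlast, Finset.sum_range_succ, Finset.sum_range_succ', hpren, hv'n,
      D.terminal_cost_Acl hLyap]
    have hs : ∑ i ∈ Finset.range n, D.stageCost (D.predict (D.step z (v 0)) v' i) (v' i) =
        ∑ i ∈ Finset.range n, D.stageCost (D.predict z v (i + 1)) (v (i + 1)) := by
      refine Finset.sum_congr rfl fun i hi => ?_
      have hi := Finset.mem_range.1 hi
      rw [hpre i hi.le]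
      simp only [hv', if_pos hi]
    rw [hs, predict]
    ring

theorem IsOptimal.feasibleAt_step {D : MPC} (hN : 1 ≤ D.N) (hv : ∀ l, D.vlo l < 0 ∧ 0 < D.vhi l)
    {Nc : ℕ} (hLyap : D.Qbar - D.Aclᵀ * D.Qbar * D.Acl = D.Q + D.Kᵀ * D.R * D.K)
    (hinv : ∀ z ∈ D.terminalSet Nc, D.Acl *ᵥ z ∈ D.terminalSet Nc)
    (hbar : ∀ z ∈ D.terminalSet Nc, D.barrier (D.Acl *ᵥ z) > (1 - D.γ) * D.barrier z)
    {z : Fin 14 → ℝ} {v : ℕ → Fin 4 → ℝ} (h : D.IsOptimal Nc z v) :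
    D.FeasibleAt Nc (D.step z (v 0)) ∧
      D.optCost Nc (D.step z (v 0)) ≤ D.optCost Nc z - D.stageCost z (v 0) := by
  obtain ⟨v', hf, hc⟩ := h.1.exists_shift hN hLyap hinv hbar
  exact ⟨⟨v', hf⟩, h.optCost_eq ▸ hc ▸ D.optCost_le hv hf⟩

theorem stageCost_le_cost (hN : 1 ≤ D.N) (hQ : D.Q.PosDef) (hR : D.R.PosSemidef)
    (hK : D.Stabilizing)
    (hLyap : D.Qbar - D.Aclᵀ * D.Qbar * D.Acl = D.Q + D.Kᵀ * D.R * D.K)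
    (z : Fin 14 → ℝ) (v : ℕ → Fin 4 → ℝ) : D.stageCost z (v 0) ≤ D.cost z v := by
  have h1 := Finset.single_le_sum (f := fun i => D.stageCost (D.predict z v i) (v i))
    (fun i _ => D.stageCost_nonneg hQ hR _ _) (Finset.mem_range.2 hN : 0 ∈ Finset.range D.N)
  have h2 := D.terminal_cost_nonneg hQ hR hK hLyap (D.predict z v D.N)
  exact h1.trans (le_add_of_nonneg_right h2)

/-- On the terminal set the terminal feedback is feasible, with cost the terminal cost. -/
theorem exists_isFeasible_of_mem_terminalSet {Nc : ℕ}
    (hLyap : D.Qbar - D.Aclᵀ * D.Qbar * D.Acl = D.Q + D.Kᵀ * D.R * D.K)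
    (hinv : ∀ z ∈ D.terminalSet Nc, D.Acl *ᵥ z ∈ D.terminalSet Nc)
    (hbar : ∀ z ∈ D.terminalSet Nc, D.barrier (D.Acl *ᵥ z) > (1 - D.γ) * D.barrier z)
    {z : Fin 14 → ℝ} (hz : z ∈ D.terminalSet Nc) :
    ∃ v, D.IsFeasible Nc z v ∧ D.cost z v = z ⬝ᵥ D.Qbar *ᵥ z := by
  set v : ℕ → Fin 4 → ℝ := fun i => D.K *ᵥ (D.Acl ^ i *ᵥ z) with hv
  have hpre : ∀ i, D.predict z v i = D.Acl ^ i *ᵥ z := by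
    intro i
    induction i with
    | zero => simp [predict]
    | succ i ih => rw [predict, ih, pow_succ', ← Matrix.mulVec_mulVec, Acl_mulVec]
  have hmem : ∀ i, D.Acl ^ i *ᵥ z ∈ D.terminalSet Nc := by
    intro i
    induction i with
    | zero => simpa using hz
    | succ i ih =>
      rw [pow_succ', ← Matrix.mulVec_mulVec]
      exact hinv _ ih
  have hok : ∀ i, D.InputOK (D.K *ᵥ (D.Acl ^ i *ᵥ z)) ∧ D.OutputOK (D.Acl ^ i *ᵥ z) := fun i => by
    have := hmem i 0 (Nat.zero_le _)
    rwa [pow_zero, Matrix.one_mulVec] at this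
  refine ⟨v, ⟨fun i _ => hpre i ▸ (hok i).2, fun i _ => (hok i).1, fun i _ => ?_,
    hpre D.N ▸ hmem D.N⟩, ?_⟩
  · rw [hpre, hpre, pow_succ', ← Matrix.mulVec_mulVec]
    linarith [hbar _ (hmem i)]
  · rw [cost]
    simp only [hpre]
    have : ∀ n : ℕ, ∑ i ∈ Finset.range n, D.stageCost (D.Acl ^ i *ᵥ z) (v i) +
        (D.Acl ^ n *ᵥ z) ⬝ᵥ D.Qbar *ᵥ (D.Acl ^ n *ᵥ z) = z ⬝ᵥ D.Qbar *ᵥ z := by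
      intro n
      induction n with
      | zero => simp
      | succ n ih =>
        rw [Finset.sum_range_succ, pow_succ', ← Matrix.mulVec_mulVec,
          D.terminal_cost_Acl hLyap (D.Acl ^ n *ᵥ z), ← ih]
        ring
    exact this D.N

/-! ### The closed loop in linearizing coordinates -/

/-- A trajectory of the discretized linear equivalent model under the MPC law. -/
def LinearLoop (Nc : ℕ) (z : ℕ → Fin 14 → ℝ) (w : ℕ → ℕ → Fin 4 → ℝ) : Prop :=
  ∀ k, (D.FeasibleAt Nc (z k) → D.IsOptimal Nc (z k) (w k)) ∧ z (k + 1) = D.step (z k) (w k 0)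

section LinearLoop

variable {D} {Nc : ℕ} {z : ℕ → Fin 14 → ℝ} {w : ℕ → ℕ → Fin 4 → ℝ}

theorem LinearLoop.feasibleAt (h : D.LinearLoop Nc z w)
    (hstep : ∀ z v, D.IsOptimal Nc z v → D.FeasibleAt Nc (D.step z (v 0)) ∧
      D.optCost Nc (D.step z (v 0)) ≤ D.optCost Nc z - D.stageCost z (v 0))
    (h0 : D.FeasibleAt Nc (z 0)) (k : ℕ) : D.FeasibleAt Nc (z k) := by
  induction k with
  | zero => exact h0
  | succ k ih =>
    rw [(h k).2]
    exact (hstep _ _ ((h k).1 ih)).1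

theorem LinearLoop.optCost_succ_le (h : D.LinearLoop Nc z w)
    (hstep : ∀ z v, D.IsOptimal Nc z v → D.FeasibleAt Nc (D.step z (v 0)) ∧
      D.optCost Nc (D.step z (v 0)) ≤ D.optCost Nc z - D.stageCost z (v 0))
    (h0 : D.FeasibleAt Nc (z 0)) (k : ℕ) :
    D.optCost Nc (z (k + 1)) ≤ D.optCost Nc (z k) - D.stageCost (z k) (w k 0) := by
  rw [(h k).2]
  exact (hstep _ _ ((h k).1 (h.feasibleAt hstep h0 k))).2

/-- The first barrier constraint makes the next barrier value at least `1 - γ` times the present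
one, and `1 - γ ≥ 0`. -/
theorem LinearLoop.barrier_nonneg (h : D.LinearLoop Nc z w) (hN : 1 ≤ D.N) (hγ' : D.γ ≤ 1)
    (hf : ∀ k, D.FeasibleAt Nc (z k)) (h0 : 0 ≤ D.barrier (z 0)) (k : ℕ) :
    0 ≤ D.barrier (z k) := by
  induction k with
  | zero => exact h0
  | succ k ih =>
    have h1 := ((h k).1 (hf k)).1.2.2.1 0 hN
    simp only [predict] at h1
    rw [(h k).2]
    nlinarith [mul_nonneg (sub_nonneg.2 hγ') ih]

theorem tendsto_zero_of_le_sub {J s : ℕ → ℝ} (hJ : ∀ k, 0 ≤ J k) (hs : ∀ k, 0 ≤ s k)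
    (h : ∀ k, J (k + 1) ≤ J k - s k) : Tendsto s atTop (𝓝 0) := by
  have hsum : ∀ n, ∑ i ∈ Finset.range n, s i ≤ J 0 - J n := by
    intro n
    induction n with
    | zero => simp
    | succ n ih =>
      rw [Finset.sum_range_succ]
      linarith [h n]
  exact (summable_of_sum_range_le hs fun n => (hsum n).trans (sub_le_self _ (hJ n))
    ).tendsto_atTop_zero

theorem LinearLoop.tendsto_zero (h : D.LinearLoop Nc z w) (hN : 1 ≤ D.N) (hQ : D.Q.PosDef)
    (hR : D.R.PosSemidef) (hK : D.Stabilizing)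
    (hLyap : D.Qbar - D.Aclᵀ * D.Qbar * D.Acl = D.Q + D.Kᵀ * D.R * D.K)
    (hf : ∀ k, D.FeasibleAt Nc (z k))
    (hdec : ∀ k, D.optCost Nc (z (k + 1)) ≤ D.optCost Nc (z k) - D.stageCost (z k) (w k 0)) :
    Tendsto z atTop (𝓝 0) := by
  have hs := tendsto_zero_of_le_sub (J := fun k => D.optCost Nc (z k)) (fun k => ?_)
    (fun k => D.stageCost_nonneg hQ hR (z k) (w k 0)) hdec
  · obtain ⟨c, hc, hcQ⟩ := exists_pos_mul_sq_norm_le_quadForm hQ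
    have h2 : Tendsto (fun k => ‖z k‖ ^ 2) atTop (𝓝 0) := by
      refine squeeze_zero (fun k => by positivity) (fun k => ?_) (by simpa using hs.const_mul c⁻¹)
      rw [← div_eq_inv_mul, le_div_iff₀ hc, mul_comm]
      have := hR.dotProduct_mulVec_nonneg (w k 0)
      rw [star_trivial] at this
      exact (hcQ _).trans (le_add_of_nonneg_right this)
    have h3 := h2.sqrt
    simp only [Real.sqrt_sq (norm_nonneg _), Real.sqrt_zero] at h3
    exact tendsto_zero_iff_norm_tendsto_zero.2 h3
  · have ho := (h k).1 (hf k)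
    simp only [ho.optCost_eq]
    exact (D.stageCost_nonneg hQ hR _ _).trans (D.stageCost_le_cost hN hQ hR hK hLyap _ _)

end LinearLoop

/-- The optimal cost is a Lyapunov function: bounded below by `c * ‖z‖ ^ 2` and, on the terminal
set, above by the continuous terminal cost. Starting in the terminal set also guarantees
feasibility, so none is assumed. -/
theorem linearLoop_stable {Nc : ℕ} (hN : 1 ≤ D.N) (hz : ∀ l, D.zlo l < 0 ∧ 0 < D.zhi l)
    (hv : ∀ l, D.vlo l < 0 ∧ 0 < D.vhi l) (hQ : D.Q.PosDef) (hR : D.R.PosSemidef)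
    (hK : D.Stabilizing)
    (hLyap : D.Qbar - D.Aclᵀ * D.Qbar * D.Acl = D.Q + D.Kᵀ * D.R * D.K)
    (hinv : ∀ z ∈ D.terminalSet Nc, D.Acl *ᵥ z ∈ D.terminalSet Nc)
    (hbar : ∀ z ∈ D.terminalSet Nc, D.barrier (D.Acl *ᵥ z) > (1 - D.γ) * D.barrier z)
    {U : Set (Fin 14 → ℝ)} (hU : U ∈ 𝓝 0) :
    ∃ V ∈ 𝓝 (0 : Fin 14 → ℝ), ∀ z w, D.LinearLoop Nc z w → z 0 ∈ V → ∀ k, z k ∈ U := by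
  obtain ⟨r, hr, hrU⟩ := Metric.mem_nhds_iff.1 hU
  obtain ⟨c, hc, hcQ⟩ := exists_pos_mul_sq_norm_le_quadForm hQ
  have hV : ∀ᶠ y : Fin 14 → ℝ in 𝓝 0, y ⬝ᵥ D.Qbar *ᵥ y < c * r ^ 2 := by
    refine ((continuous_quadForm D.Qbar).tendsto 0).eventually_lt_const ?_
    simp only [zero_dotProduct]
    positivity
  refine ⟨_, inter_mem (D.terminalSet_mem_nhds hz hv Nc) hV, ?_⟩
  rintro z w h ⟨hz0, hz0'⟩ k
  obtain ⟨v, hvf, hvc⟩ := D.exists_isFeasible_of_mem_terminalSet hLyap hinv hbar hz0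
  have hstep := fun z v (h : D.IsOptimal Nc z v) => h.feasibleAt_step hN hv hLyap hinv hbar
  have hf := h.feasibleAt hstep ⟨v, hvf⟩
  have hdec := h.optCost_succ_le hstep ⟨v, hvf⟩
  have hanti : D.optCost Nc (z k) ≤ D.optCost Nc (z 0) :=
    antitone_nat_of_succ_le (f := fun k => D.optCost Nc (z k)) (fun k => (hdec k).trans
      (sub_le_self _ (D.stageCost_nonneg hQ hR _ _))) (Nat.zero_le k)
  have ho := (h k).1 (hf k)
  have h1 : c * ‖z k‖ ^ 2 < c * r ^ 2 := by
    calc c * ‖z k‖ ^ 2 ≤ z k ⬝ᵥ D.Q *ᵥ z k := hcQ _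
      _ ≤ D.stageCost (z k) (w k 0) := by
          have := hR.dotProduct_mulVec_nonneg (w k 0)
          rw [star_trivial] at this
          exact le_add_of_nonneg_right this
      _ ≤ D.cost (z k) (w k) := D.stageCost_le_cost hN hQ hR hK hLyap _ _
      _ = D.optCost Nc (z k) := ho.optCost_eq.symm
      _ ≤ D.cost (z 0) v := hanti.trans (D.optCost_le hv hvf)
      _ < c * r ^ 2 := hvc ▸ hz0'
  refine hrU (mem_ball_zero_iff.2 ?_)
  exact lt_of_pow_lt_pow_left₀ 2 hr.le (lt_of_mul_lt_mul_left h1 hc.le)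

end MPC


/-! ### Lie derivatives of the outputs -/

theorem outLie_zero (p : Params) (i : Fin 4) : outLie p i 0 = output i := rfl

theorem outLie_succ (p : Params) (i : Fin 4) (n : ℕ) :
    outLie p i (n + 1) = lieDeriv (extDrift p) (outLie p i n) :=
  Function.iterate_succ_apply' _ _ _

/-- A coordinate of the vehicle state, as a continuous linear form. -/
def coord (i : Fin 12) : ExtState →L[ℝ] ℝ :=
  (ContinuousLinearMap.proj i).comp (ContinuousLinearMap.fst ℝ State (ℝ × ℝ))

/-- The thrust, as a continuous linear form. -/
def thrustCoord : ExtState →L[ℝ] ℝ :=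
  (ContinuousLinearMap.fst ℝ ℝ ℝ).comp (ContinuousLinearMap.snd ℝ State (ℝ × ℝ))

theorem differentiableAt_rot (i j : Fin 3) (X : ExtState) :
    DifferentiableAt ℝ (fun X : ExtState => rot (X.1 3) (X.1 4) (X.1 5) i j) X := by
  fin_cases i <;> fin_cases j <;> simp [rot] <;> fun_prop

theorem fderiv_coord (i : Fin 12) (X W : ExtState) :
    fderiv ℝ (fun X : ExtState => X.1 i) X W = W.1 i := by
  change fderiv ℝ (coord i) X W = W.1 i
  rw [ContinuousLinearMap.fderiv]
  rfl

/-- The unit vector in the third column of `rot` moves orthogonally to itself, so its derivative is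
a combination of the first two columns. The direction `W` is arbitrary, to serve both drift and
input fields. -/
theorem fderiv_thrust_axis (i : Fin 3) (X W : ExtState) :
    fderiv ℝ (fun X : ExtState => rot (X.1 3) (X.1 4) (X.1 5) i 2) X W =
      (Real.cos (X.1 3) * W.1 4 + Real.cos (X.1 4) * Real.sin (X.1 3) * W.1 5) *
        rot (X.1 3) (X.1 4) (X.1 5) i 0 +
      (Real.sin (X.1 4) * W.1 5 - W.1 3) * rot (X.1 3) (X.1 4) (X.1 5) i 1 := by
  have h3 : HasFDerivAt (fun X : ExtState => X.1 3) (coord 3) X := (coord 3).hasFDerivAt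
  have h4 : HasFDerivAt (fun X : ExtState => X.1 4) (coord 4) X := (coord 4).hasFDerivAt
  have h5 : HasFDerivAt (fun X : ExtState => X.1 5) (coord 5) X := (coord 5).hasFDerivAt
  have e4 := Real.sin_sq_add_cos_sq (X.1 4)
  fin_cases i
  · have h := (h3.sin.mul h5.sin).add ((h3.cos.mul h5.cos).mul h4.sin)
    refine (congrArg (fun L => L W) h.fderiv).trans ?_
    simp [rot, coord]
    linear_combination -(Real.sin (X.1 3) * Real.cos (X.1 5) * W.1 5) * e4
  · have h := ((h3.cos.mul h5.sin).mul h4.sin).sub (h5.cos.mul h3.sin)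
    refine (congrArg (fun L => L W) h.fderiv).trans ?_
    simp [rot, coord]
    linear_combination -(Real.sin (X.1 5) * Real.sin (X.1 3) * W.1 5) * e4
  · have h := h3.cos.mul h4.cos
    refine (congrArg (fun L => L W) h.fderiv).trans ?_
    simp [rot, coord]
    ring

theorem differentiableAt_coord (i : Fin 12) (X : ExtState) :
    DifferentiableAt ℝ (fun X : ExtState => X.1 i) X :=
  (coord i).differentiableAt

theorem outLie_position_one (p : Params) (i : Fin 3) :
    outLie p i.castSucc 1 = fun X => X.1 (![6, 7, 8] i) := by
  funext X
  rw [outLie_succ, outLie_zero]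
  refine (fderiv_coord (![0, 1, 2, 5] i.castSucc) X (extDrift p X)).trans ?_
  fin_cases i <;> simp [extDrift, drift, inputField]

theorem outLie_position_two (p : Params) (i : Fin 3) :
    outLie p i.castSucc 2 =
      fun X => X.2.1 / p.m * rot (X.1 3) (X.1 4) (X.1 5) i 2 - ![0, 0, p.grav] i := by
  funext X
  rw [outLie_succ, outLie_position_one]
  refine (fderiv_coord _ X (extDrift p X)).trans ?_
  fin_cases i <;> simp [extDrift, drift, inputField] <;> ring

theorem outLie_yaw_one (p : Params) :
    outLie p 3 1 = fun X => X.1 10 * Real.sin (X.1 3) / Real.cos (X.1 4) +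
      X.1 11 * Real.cos (X.1 3) / Real.cos (X.1 4) := by
  funext X
  rw [outLie_succ, outLie_zero]
  refine (fderiv_coord 5 X (extDrift p X)).trans ?_
  simp [extDrift, drift, inputField]

theorem hasFDerivAt_thrustAccel (p : Params) (i : Fin 3) (X : ExtState) :
    HasFDerivAt
      (fun X : ExtState => X.2.1 / p.m * rot (X.1 3) (X.1 4) (X.1 5) i 2 - ![0, 0, p.grav] i)
      ((X.2.1 / p.m) • fderiv ℝ (fun X : ExtState => rot (X.1 3) (X.1 4) (X.1 5) i 2) X +
        rot (X.1 3) (X.1 4) (X.1 5) i 2 • (p.m⁻¹ • thrustCoord)) X := by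
  have h1 : HasFDerivAt (fun X : ExtState => X.2.1 / p.m) (p.m⁻¹ • thrustCoord) X := by
    have h : HasFDerivAt (fun X : ExtState => p.m⁻¹ * X.2.1) (p.m⁻¹ • thrustCoord) X :=
      thrustCoord.hasFDerivAt.const_mul p.m⁻¹
    simpa only [div_eq_inv_mul] using h
  exact (h1.mul (differentiableAt_rot i 2 X).hasFDerivAt).sub_const _

theorem fderiv_outLie_position_two (p : Params) (i : Fin 3) (X W : ExtState) :
    fderiv ℝ (outLie p i.castSucc 2) X W =
      W.2.1 / p.m * rot (X.1 3) (X.1 4) (X.1 5) i 2 +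
      X.2.1 / p.m *
        ((Real.cos (X.1 3) * W.1 4 + Real.cos (X.1 4) * Real.sin (X.1 3) * W.1 5) *
          rot (X.1 3) (X.1 4) (X.1 5) i 0 +
        (Real.sin (X.1 4) * W.1 5 - W.1 3) * rot (X.1 3) (X.1 4) (X.1 5) i 1) := by
  rw [outLie_position_two, (hasFDerivAt_thrustAccel p i X).fderiv, ← fderiv_thrust_axis]
  simp [thrustCoord]
  ring

/-- The jerk of the vehicle. -/
theorem outLie_position_three (p : Params) (i : Fin 3) {X : ExtState}
    (hX : Real.cos (X.1 4) ≠ 0) :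
    outLie p i.castSucc 3 X =
      X.2.2 / p.m * rot (X.1 3) (X.1 4) (X.1 5) i 2 +
      X.2.1 / p.m * (X.1 10 * rot (X.1 3) (X.1 4) (X.1 5) i 0 -
        X.1 9 * rot (X.1 3) (X.1 4) (X.1 5) i 1) := by
  rw [outLie_succ, lieDeriv, fderiv_outLie_position_two]
  have e3 := Real.sin_sq_add_cos_sq (X.1 3)
  have h3 : (extDrift p X).1 3 = X.1 9 + X.1 10 * Real.sin (X.1 3) * Real.tan (X.1 4) +
      X.1 11 * Real.cos (X.1 3) * Real.tan (X.1 4) := by simp [extDrift, drift, inputField]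
  have h4 : (extDrift p X).1 4 = X.1 10 * Real.cos (X.1 3) - X.1 11 * Real.sin (X.1 3) := by
    simp [extDrift, drift, inputField]
  have h5 : (extDrift p X).1 5 = X.1 10 * Real.sin (X.1 3) / Real.cos (X.1 4) +
      X.1 11 * Real.cos (X.1 3) / Real.cos (X.1 4) := by simp [extDrift, drift, inputField]
  -- Along the drift, the Euler-angle kinematics collapse these two coefficients to the body rates
  -- `Ω_y` and `-Ω_x`.
  have hp : Real.cos (X.1 3) * (extDrift p X).1 4 +
      Real.cos (X.1 4) * Real.sin (X.1 3) * (extDrift p X).1 5 = X.1 10 := by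
    rw [h4, h5]
    field_simp
    linear_combination X.1 10 * e3
  have hr : Real.sin (X.1 4) * (extDrift p X).1 5 - (extDrift p X).1 3 = -X.1 9 := by
    rw [h3, h5, Real.tan_eq_sin_div_cos]
    ring
  rw [hp, hr, show (extDrift p X).2.1 = X.2.2 from rfl]
  ring

theorem eventually_cos_pitch_ne_zero {X : ExtState} (hX : Real.cos (X.1 4) ≠ 0) :
    ∀ᶠ Y : ExtState in 𝓝 X, Real.cos (Y.1 4) ≠ 0 :=
  (Real.continuous_cos.comp (coord 4).continuous).continuousAt.eventually_ne hX

/-- The jerk formula needs nonzero cosine of pitch, an open condition, so it holds on a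
neighbourhood. -/
theorem differentiableAt_outLie_position_three (p : Params) (i : Fin 3) {X : ExtState}
    (hX : Real.cos (X.1 4) ≠ 0) : DifferentiableAt ℝ (outLie p i.castSucc 3) X := by
  have h : outLie p i.castSucc 3 =ᶠ[𝓝 X] fun X =>
      X.2.2 / p.m * rot (X.1 3) (X.1 4) (X.1 5) i 2 +
      X.2.1 / p.m * (X.1 10 * rot (X.1 3) (X.1 4) (X.1 5) i 0 -
        X.1 9 * rot (X.1 3) (X.1 4) (X.1 5) i 1) :=
    (eventually_cos_pitch_ne_zero hX).mono fun Y hY => outLie_position_three p i hY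
  refine DifferentiableAt.congr_of_eventuallyEq ?_ h
  have h0 := differentiableAt_rot i 0 X
  have h1 := differentiableAt_rot i 1 X
  have h2 := differentiableAt_rot i 2 X
  fun_prop

theorem differentiableAt_outLie_yaw_one (p : Params) {X : ExtState}
    (hX : Real.cos (X.1 4) ≠ 0) : DifferentiableAt ℝ (outLie p 3 1) X := by
  rw [outLie_yaw_one]
  fun_prop (disch := exact hX)

theorem differentiableAt_stateMap (p : Params) {X : ExtState} (hX : Real.cos (X.1 4) ≠ 0) :
    DifferentiableAt ℝ (stateMap p) X := by
  have h0 : ∀ i, DifferentiableAt ℝ (outLie p i 0) X := fun i => differentiableAt_coord _ X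
  have h1 : ∀ i : Fin 3, DifferentiableAt ℝ (outLie p i.castSucc 1) X := fun i => by
    rw [outLie_position_one]
    exact differentiableAt_coord _ X
  have h2 : ∀ i : Fin 3, DifferentiableAt ℝ (outLie p i.castSucc 2) X := fun i => by
    rw [outLie_position_two]
    exact (hasFDerivAt_thrustAccel p i X).differentiableAt
  have h3 := fun i => differentiableAt_outLie_position_three p i hX
  rw [differentiableAt_pi]
  intro i
  fin_cases i
  exacts [h0 0, h1 0, h2 0, h3 0, h0 1, h1 1, h2 1, h3 1, h0 2, h1 2, h2 2, h3 2, h0 3,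
    differentiableAt_outLie_yaw_one p hX]

/-! ### Exact linearization by the feedback -/

theorem fderiv_dflField (p : Params) (l : ExtState → ℝ) (X : ExtState) (v : Fin 4 → ℝ) :
    fderiv ℝ l X (dflField p X v) =
      lieDeriv (extDrift p) l X + ∑ j, dfl p X v j * lieDeriv (extInputField p j) l X := by
  simp [dflField, lieDeriv]

theorem extInputField_fst_eq_zero (p : Params) (j : Fin 4) (X : ExtState) {k : Fin 12}
    (hk : k ≤ 8) : (extInputField p j X).1 k = 0 := by
  fin_cases j <;> fin_cases k <;> first | (simp [extInputField, inputField]; done) | exact absurd hk (by decide)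

theorem extInputField_thrust_eq_zero (p : Params) (j : Fin 4) (X : ExtState) :
    (extInputField p j X).2.1 = 0 := by
  rw [extInputField]
  split_ifs <;> rfl

theorem fderiv_outLie_dflField_of_lt (p : Params) {i : Fin 4} {n : ℕ} {X : ExtState}
    (v : Fin 4 → ℝ) (h : ∀ j, lieDeriv (extInputField p j) (outLie p i n) X = 0) :
    fderiv ℝ (outLie p i n) X (dflField p X v) = outLie p i (n + 1) X := by
  simp [fderiv_dflField, h, outLie_succ]

/-- At the last derivative of a chain, the decoupling matrix times the feedback cancels the drift
term and leaves `v i`. -/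
theorem fderiv_outLie_dflField_of_relDeg (p : Params) (i : Fin 4) {n : ℕ} {X : ExtState}
    (hX : IsUnit (decoupling p X).det) (v : Fin 4 → ℝ) (hn : relDeg i = n + 1) :
    fderiv ℝ (outLie p i n) X (dflField p X v) = v i := by
  have h : (decoupling p X *ᵥ dfl p X v) i = -outLie p i (relDeg i) X + v i := by
    rw [dfl, Matrix.mulVec_mulVec, Matrix.mul_nonsing_inv _ hX, Matrix.one_mulVec]
    rfl
  simp only [Matrix.mulVec, dotProduct, decoupling, Matrix.of_apply, hn, Nat.add_sub_cancel,
    outLie_succ] at h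
  rw [fderiv_dflField]
  simp only [mul_comm (dfl p X v _)]
  rw [h]
  ring

theorem fderiv_stateMap_dflField (p : Params) {X : ExtState} (hX : Real.cos (X.1 4) ≠ 0)
    (hA : IsUnit (decoupling p X).det) (v : Fin 4 → ℝ) :
    fderiv ℝ (stateMap p) X (dflField p X v) = Az *ᵥ stateMap p X + Bz *ᵥ v := by
  have h0 : ∀ i, fderiv ℝ (outLie p i 0) X (dflField p X v) = outLie p i 1 X := fun i =>
    fderiv_outLie_dflField_of_lt p v fun j => (fderiv_coord _ X _).trans
      (extInputField_fst_eq_zero p j X (by revert i; decide))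
  have h1 : ∀ i : Fin 3, fderiv ℝ (outLie p i.castSucc 1) X (dflField p X v) =
      outLie p i.castSucc 2 X := fun i =>
    fderiv_outLie_dflField_of_lt p v fun j => by
      rw [outLie_position_one]
      exact (fderiv_coord _ X _).trans
        (extInputField_fst_eq_zero p j X (by revert i; decide))
  -- Acceleration depends only on thrust and Euler angles, which no input drives directly after the
  -- extension.
  have h2 : ∀ i : Fin 3, fderiv ℝ (outLie p i.castSucc 2) X (dflField p X v) =
      outLie p i.castSucc 3 X := fun i =>
    fderiv_outLie_dflField_of_lt p v fun j => by
      rw [lieDeriv, fderiv_outLie_position_two, extInputField_thrust_eq_zero,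
        extInputField_fst_eq_zero p j X (k := 3) (by decide),
        extInputField_fst_eq_zero p j X (k := 4) (by decide),
        extInputField_fst_eq_zero p j X (k := 5) (by decide)]
      ring
  have h3 : ∀ (i : Fin 4) {n : ℕ}, relDeg i = n + 1 → _ := fun i _ =>
    fderiv_outLie_dflField_of_relDeg p i hA v
  rw [Az_mulVec_add_Bz_mulVec]
  ext i
  refine (DFunLike.congr_fun (fderiv_apply (differentiableAt_stateMap p hX) i)
    (dflField p X v)).symm.trans ?_
  fin_cases i
  exacts [h0 0, h1 0, h2 0, h3 0 rfl, h0 1, h1 1, h2 1, h3 1 rfl, h0 2, h1 2, h2 2, h3 2 rfl,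
    h0 3, h3 3 rfl]

theorem Admissible.cos_roll_pos {p : Params} {X : ExtState} (h : Admissible p X) :
    0 < Real.cos (X.1 3) := Real.cos_pos_of_mem_Ioo h.1

theorem Admissible.cos_pitch_pos {p : Params} {X : ExtState} (h : Admissible p X) :
    0 < Real.cos (X.1 4) := Real.cos_pos_of_mem_Ioo h.2.1

theorem MPC.ClosedLoop.linearLoop {D : MPC} {p : Params} {Nc : ℕ} {X : ℕ → ExtState}
    {w : ℕ → ℕ → Fin 4 → ℝ} (h : D.ClosedLoop p Nc X w) :
    D.LinearLoop Nc (fun k => stateMap p (X k)) w := fun k => by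
  obtain ⟨hadm, hopt, hnext⟩ := h k
  refine ⟨hopt, ?_⟩
  simp only [hnext, D.step_eq,
    fderiv_stateMap_dflField p hadm.cos_pitch_pos.ne' hadm.2.2 (w k 0)]


/-! ### The state mapping near hover -/

theorem rot_transpose_mul_self (φ θ ψ : ℝ) : (rot φ θ ψ)ᵀ * rot φ θ ψ = 1 := by
  have e1 := Real.sin_sq_add_cos_sq φ
  have e2 := Real.sin_sq_add_cos_sq θ
  have e3 := Real.sin_sq_add_cos_sq ψ
  ext i j
  fin_cases i <;> fin_cases j <;>
    simp [rot, Matrix.mul_apply, Fin.sum_univ_three] <;> grind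

theorem sum_rot_mul_rot (φ θ ψ : ℝ) (j k : Fin 3) :
    ∑ i, rot φ θ ψ i j * rot φ θ ψ i k = if j = k then 1 else 0 := by
  have h := congrFun (congrFun (rot_transpose_mul_self φ θ ψ) j) k
  rwa [Matrix.mul_apply, Matrix.one_apply] at h

theorem rot_zero : rot 0 0 0 = 1 := by
  ext i j
  fin_cases i <;> fin_cases j <;> simp [rot]

theorem stateMap_hover (p : Params) : stateMap p (hover p) = 0 := by
  have hc : Real.cos ((hover p).1 4) ≠ 0 := by simp [hover]
  have hm := p.m_pos.ne'
  have h0 : ∀ i, outLie p i 0 (hover p) = 0 := fun i => rfl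
  have h1 : ∀ i : Fin 3, outLie p i.castSucc 1 (hover p) = 0 := fun i => by
    rw [outLie_position_one]
    rfl
  have h2 : ∀ i : Fin 3, outLie p i.castSucc 2 (hover p) = 0 := fun i => by
    rw [outLie_position_two]
    fin_cases i <;> simp [hover, rot, hm]
  have h3 : ∀ i : Fin 3, outLie p i.castSucc 3 (hover p) = 0 := fun i => by
    rw [outLie_position_three p i hc]
    simp [hover]
  have h4 : outLie p 3 1 (hover p) = 0 := by
    rw [outLie_yaw_one]
    simp [hover]
  ext i
  fin_cases i
  exacts [h0 0, h1 0, h2 0, h3 0, h0 1, h1 1, h2 1, h3 1, h0 2, h1 2, h2 2, h3 2, h0 3, h4]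

theorem tendsto_stateMap_hover (p : Params) : Tendsto (stateMap p) (𝓝 (hover p)) (𝓝 0) := by
  have h := (differentiableAt_stateMap p (X := hover p) (by simp [hover])).continuousAt.tendsto
  rwa [stateMap_hover] at h

/-- On this interval `|a| = arccos (cos a)`, and `arccos` is continuous with value 0 at 1. -/
theorem tendsto_zero_of_tendsto_cos {ι : Type*} {l : Filter ι} {a : ι → ℝ}
    (ha : ∀ᶠ k in l, a k ∈ Set.Ioo (-(Real.pi / 2)) (Real.pi / 2))
    (h : Tendsto (fun k => Real.cos (a k)) l (𝓝 1)) : Tendsto a l (𝓝 0) := by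
  rw [tendsto_zero_iff_abs_tendsto_zero]
  have h1 := (Real.continuous_arccos.tendsto 1).comp h
  rw [Real.arccos_one] at h1
  refine h1.congr' (ha.mono fun k hk => ?_)
  simp only [Function.comp_apply]
  rw [← Real.cos_abs, Real.arccos_cos (abs_nonneg _)]
  have := abs_lt.2 hk
  linarith [Real.pi_pos]

/-- On the admissible set, the state mapping is small only near hover. -/
theorem tendsto_hover_of_tendsto_stateMap (p : Params) {ι : Type*} {l : Filter ι}
    {X : ι → ExtState} (hadm : ∀ᶠ k in l, Admissible p (X k))
    (h : Tendsto (fun k => stateMap p (X k)) l (𝓝 0)) : Tendsto X l (𝓝 (hover p)) := by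
  have hc : ∀ j, Tendsto (fun k => stateMap p (X k) j) l (𝓝 0) := fun j =>
    tendsto_pi_nhds.1 h j
  have hg := p.grav_pos
  have hm := p.m_pos
  have hpos : ∀ i : Fin 3, Tendsto (fun k => (X k).1 (![0, 1, 2, 5] i.castSucc)) l (𝓝 0) := by
    intro i
    fin_cases i
    exacts [hc 0, hc 4, hc 8]
  have hyaw : Tendsto (fun k => (X k).1 5) l (𝓝 0) := hc 12
  have hvel : ∀ i : Fin 3, Tendsto (fun k => (X k).1 (![6, 7, 8] i)) l (𝓝 0) := by
    have h' : ∀ i : Fin 3, Tendsto (fun k => outLie p i.castSucc 1 (X k)) l (𝓝 0) := by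
      intro i
      fin_cases i
      exacts [hc 1, hc 5, hc 9]
    simpa only [outLie_position_one] using h'
  set r : ι → Matrix (Fin 3) (Fin 3) ℝ := fun k => rot ((X k).1 3) ((X k).1 4) ((X k).1 5) with hr
  have hacc : ∀ i : Fin 3, Tendsto (fun k => (X k).2.1 / p.m * r k i 2) l
      (𝓝 (![0, 0, p.grav] i)) := by
    have h' : ∀ i : Fin 3, Tendsto (fun k => outLie p i.castSucc 2 (X k)) l (𝓝 0) := by
      intro i
      fin_cases i
      exacts [hc 2, hc 6, hc 10]
    intro i
    have := (h' i).add_const (![0, 0, p.grav] i)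
    simpa only [outLie_position_two, sub_add_cancel, zero_add] using this
  have hjerk : ∀ i : Fin 3, Tendsto (fun k => (X k).2.2 / p.m * r k i 2 +
      (X k).2.1 / p.m * ((X k).1 10 * r k i 0 - (X k).1 9 * r k i 1)) l (𝓝 0) := by
    have h' : ∀ i : Fin 3, Tendsto (fun k => outLie p i.castSucc 3 (X k)) l (𝓝 0) := by
      intro i
      fin_cases i
      exacts [hc 3, hc 7, hc 11]
    intro i
    exact (h' i).congr' (hadm.mono fun k hk => outLie_position_three p i hk.cos_pitch_pos.ne')
  have hyawRate : Tendsto (fun k => (X k).1 10 * Real.sin ((X k).1 3) / Real.cos ((X k).1 4) +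
      (X k).1 11 * Real.cos ((X k).1 3) / Real.cos ((X k).1 4)) l (𝓝 0) := by
    have h' : Tendsto (fun k => outLie p 3 1 (X k)) l (𝓝 0) := hc 13
    simpa only [outLie_yaw_one] using h'
  have hcc : ∀ k, r k 2 2 = Real.cos ((X k).1 3) * Real.cos ((X k).1 4) := fun k => by
    simp [hr, rot]
  have hthrust : Tendsto (fun k => (X k).2.1 / p.m) l (𝓝 p.grav) := by
    have h1 : Tendsto (fun k => ∑ i, ((X k).2.1 / p.m * r k i 2) ^ 2) l (𝓝 (p.grav ^ 2)) := by
      have := tendsto_finsetSum Finset.univ fun i _ => (hacc i).pow 2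
      simpa [Fin.sum_univ_three] using this
    have h2 := h1.sqrt
    rw [Real.sqrt_sq hg.le] at h2
    refine h2.congr' ?_
    filter_upwards [hadm, (hacc 2).eventually (lt_mem_nhds hg)] with k hk hk'
    rw [hcc] at hk'
    -- The norm of the thrust acceleration gives thrust only up to sign. The sign is positive
    -- because the vertical component is near `grav` and the cosines are positive.
    have h3 : 0 < (X k).2.1 / p.m :=
      pos_of_mul_pos_left hk' (mul_pos hk.cos_roll_pos hk.cos_pitch_pos).le
    have h4 : ∑ i, ((X k).2.1 / p.m * r k i 2) ^ 2 = ((X k).2.1 / p.m) ^ 2 := by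
      have h5 := sum_rot_mul_rot ((X k).1 3) ((X k).1 4) ((X k).1 5) 2 2
      simp only [mul_pow, ← Finset.mul_sum, sq (r k _ 2)]
      rw [h5]
      simp
    rw [h4, Real.sqrt_sq h3.le]
  have hcos : Tendsto (fun k => Real.cos ((X k).1 3) * Real.cos ((X k).1 4)) l (𝓝 1) := by
    have h1 := (hacc 2).div hthrust hg.ne'
    simp only [hcc] at h1
    rw [show (![0, 0, p.grav] : Fin 3 → ℝ) 2 = p.grav from rfl, div_self hg.ne'] at h1
    refine h1.congr' ?_
    filter_upwards [hthrust.eventually (lt_mem_nhds hg)] with k hk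
    exact mul_div_cancel_left₀ _ hk.ne'
  -- Each cosine is squeezed between the product of both cosines and 1.
  have hroll : Tendsto (fun k => (X k).1 3) l (𝓝 0) := by
    refine tendsto_zero_of_tendsto_cos (hadm.mono fun k hk => hk.1) ?_
    refine tendsto_of_tendsto_of_tendsto_of_le_of_le' hcos tendsto_const_nhds ?_
      (Eventually.of_forall fun k => Real.cos_le_one _)
    exact hadm.mono fun k hk => mul_le_of_le_one_right hk.cos_roll_pos.le (Real.cos_le_one _)
  have hpitch : Tendsto (fun k => (X k).1 4) l (𝓝 0) := by
    refine tendsto_zero_of_tendsto_cos (hadm.mono fun k hk => hk.2.1) ?_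
    refine tendsto_of_tendsto_of_tendsto_of_le_of_le' hcos tendsto_const_nhds ?_
      (Eventually.of_forall fun k => Real.cos_le_one _)
    exact hadm.mono fun k hk => mul_le_of_le_one_left hk.cos_pitch_pos.le (Real.cos_le_one _)
  have hrot : ∀ i j, Tendsto (fun k => r k i j) l (𝓝 ((1 : Matrix (Fin 3) (Fin 3) ℝ) i j)) := by
    intro i j
    have h1 : Continuous fun a : ℝ × ℝ × ℝ => rot a.1 a.2.1 a.2.2 i j := by
      fin_cases i <;> fin_cases j <;> simp [rot] <;> fun_prop
    have h2 := (h1.tendsto (0, 0, 0)).comp (hroll.prodMk_nhds (hpitch.prodMk_nhds hyaw))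
    rw [← rot_zero]
    exact h2
  -- Projecting the jerk onto the orthonormal columns of the rotation isolates the thrust rate and
  -- the rates `Ω_y`, `Ω_x`, the latter two multiplied by `± ζ / m`.
  have hproj : ∀ j, Tendsto (fun k => ∑ i, ((X k).2.2 / p.m * r k i 2 +
      (X k).2.1 / p.m * ((X k).1 10 * r k i 0 - (X k).1 9 * r k i 1)) * r k i j) l (𝓝 0) := by
    intro j
    simpa using tendsto_finsetSum Finset.univ fun i _ => (hjerk i).mul (hrot i j)
  have hproj_eq : ∀ k j, ∑ i, ((X k).2.2 / p.m * r k i 2 +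
      (X k).2.1 / p.m * ((X k).1 10 * r k i 0 - (X k).1 9 * r k i 1)) * r k i j =
      (X k).2.2 / p.m * (if 2 = j then 1 else 0) + (X k).2.1 / p.m *
        ((X k).1 10 * (if 0 = j then 1 else 0) - (X k).1 9 * (if 1 = j then 1 else 0)) := by
    intro k j
    simp only [← sum_rot_mul_rot ((X k).1 3) ((X k).1 4) ((X k).1 5), Fin.sum_univ_three, hr]
    ring
  simp only [hproj_eq] at hproj
  have hthrustRate : Tendsto (fun k => (X k).2.2) l (𝓝 0) := by
    have h1 := (hproj 2).mul_const p.m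
    simpa [hm.ne'] using h1
  have hne : ∀ᶠ k in l, (X k).2.1 / p.m ≠ 0 :=
    (hthrust.eventually (lt_mem_nhds hg)).mono fun k hk => hk.ne'
  have hΩy : Tendsto (fun k => (X k).1 10) l (𝓝 0) := by
    have h1 := (hproj 0).div hthrust hg.ne'
    rw [zero_div] at h1
    refine h1.congr' (hne.mono fun k hk => ?_)
    simp [mul_div_cancel_left₀ _ hk]
  have hΩx : Tendsto (fun k => (X k).1 9) l (𝓝 0) := by
    have h1 := ((hproj 1).div hthrust hg.ne').neg
    rw [zero_div, neg_zero] at h1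
    refine h1.congr' (hne.mono fun k hk => ?_)
    simp [neg_div, mul_div_cancel_left₀ _ hk]
  have hcr : Tendsto (fun k => Real.cos ((X k).1 3)) l (𝓝 1) := by
    simpa [Function.comp_def] using (Real.continuous_cos.tendsto 0).comp hroll
  have hsr : Tendsto (fun k => Real.sin ((X k).1 3)) l (𝓝 0) := by
    simpa [Function.comp_def] using (Real.continuous_sin.tendsto 0).comp hroll
  have hcp : Tendsto (fun k => Real.cos ((X k).1 4)) l (𝓝 1) := by
    simpa [Function.comp_def] using (Real.continuous_cos.tendsto 0).comp hpitch
  have hΩz : Tendsto (fun k => (X k).1 11) l (𝓝 0) := by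
    have h1 := ((hyawRate.mul hcp).sub (hΩy.mul hsr)).div hcr one_ne_zero
    simp only [mul_zero, zero_mul, sub_zero, zero_div] at h1
    refine h1.congr' (hadm.mono fun k hk => ?_)
    have := hk.cos_roll_pos.ne'
    have := hk.cos_pitch_pos.ne'
    simp only [Pi.div_apply]
    field_simp
    ring
  have hζ : Tendsto (fun k => (X k).2.1) l (𝓝 (p.m * p.grav)) := by
    have h1 := hthrust.const_mul p.m
    simpa only [mul_div_cancel₀ _ hm.ne'] using h1
  have hx : Tendsto (fun k => (X k).1) l (𝓝 0) := by
    rw [tendsto_pi_nhds]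
    intro i
    fin_cases i
    exacts [hpos 0, hpos 1, hpos 2, hroll, hpitch, hyaw, hvel 0, hvel 1, hvel 2, hΩx, hΩy, hΩz]
  exact hx.prodMk_nhds (hζ.prodMk_nhds hthrustRate)

/-! ### Transfer to the UAV -/

theorem MPC.barrier_stateMap_nonneg_iff (D : MPC) (p : Params) (X : ExtState) :
    0 ≤ D.barrier (stateMap p X) ↔ D.AvoidsObstacle X :=
  sub_nonneg

theorem MPC.closedLoop_stable (D : MPC) (p : Params) {Nc : ℕ}
    (hlin : ∀ U ∈ 𝓝 (0 : Fin 14 → ℝ), ∃ V ∈ 𝓝 (0 : Fin 14 → ℝ), ∀ z w, D.LinearLoop Nc z w →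
      z 0 ∈ V → ∀ k, z k ∈ U) {ε : ℝ} (hε : 0 < ε) :
    ∃ η > 0, ∀ (X : ℕ → ExtState) (w : ℕ → ℕ → Fin 4 → ℝ),
      D.ClosedLoop p Nc X w → dist (X 0) (hover p) < η → ∀ k, dist (X k) (hover p) < ε := by
  -- This filter statement yields a neighbourhood `U` of 0 such that every admissible state mapped
  -- into `U` is within `ε` of hover.
  have h1 : Tendsto id (𝓟 {X | Admissible p X} ⊓ comap (stateMap p) (𝓝 0)) (𝓝 (hover p)) :=
    tendsto_hover_of_tendsto_stateMap p (mem_inf_of_left (mem_principal_self _))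
      (tendsto_comap.mono_left inf_le_right)
  have h2 := h1 (Metric.ball_mem_nhds _ hε)
  rw [mem_map, inf_comm, mem_inf_principal, mem_comap] at h2
  obtain ⟨U, hU, hUε⟩ := h2
  obtain ⟨V, hV, hVU⟩ := hlin U hU
  obtain ⟨η, hη, hηV⟩ := Metric.mem_nhds_iff.1 (tendsto_stateMap_hover p hV)
  refine ⟨η, hη, fun X w hX h0 k => ?_⟩
  exact hUε (hVU _ w hX.linearLoop (hηV h0) k) (hX k).1

end VTOL

end

/-! ### The main theorem -/

theorem theorem1 (p : VTOL.Params) (D : VTOL.MPC)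
    (hδ : 0 < D.δ) (hN : 1 ≤ D.N) (hγ : 0 < D.γ) (hγ' : D.γ ≤ 1) (hrad : 0 < D.rad)
    (hz : ∀ l, D.zlo l < 0 ∧ 0 < D.zhi l) (hv : ∀ l, D.vlo l < 0 ∧ 0 < D.vhi l)
    (hQ : D.Q.PosDef) (hR : D.R.PosSemidef)
    (hK : D.Stabilizing)
    (hLyap : D.Qbar - D.Aclᵀ * D.Qbar * D.Acl = D.Q + D.Kᵀ * D.R * D.K) :
    -- the terminal cost is the infinite-horizon cost of the terminal feedback
    (∀ z : Fin 14 → ℝ,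
      HasSum (fun i : ℕ => D.stageCost (D.Acl ^ i *ᵥ z) (D.K *ᵥ (D.Acl ^ i *ᵥ z)))
        (z ⬝ᵥ D.Qbar *ᵥ z)) ∧
    -- all sufficiently large constraint checking horizons
    ∃ N₀ : ℕ, ∀ Nc ≥ N₀,
      (∀ z ∈ D.terminalSet Nc, D.barrier (D.Acl *ᵥ z) > (1 - D.γ) * D.barrier z) →
      -- the optimization problem has a minimizer whenever it is feasible
      (∀ z, D.FeasibleAt Nc z → ∃ v, D.IsOptimal Nc z v) ∧
      -- recursive feasibility and cost decrease of the linear MPC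
      (∀ z v, D.IsOptimal Nc z v → D.FeasibleAt Nc (D.step z (v 0)) ∧
        D.optCost Nc (D.step z (v 0)) ≤ D.optCost Nc z - D.stageCost z (v 0)) ∧
      -- closed-loop UAV, initially feasible: recursive feasibility, cost decrease,
      -- obstacle avoidance, convergence to hover
      (∀ (X : ℕ → VTOL.ExtState) (w : ℕ → ℕ → Fin 4 → ℝ), D.ClosedLoop p Nc X w →
        D.FeasibleAt Nc (VTOL.stateMap p (X 0)) →
        (∀ k, D.FeasibleAt Nc (VTOL.stateMap p (X k))) ∧
        (∀ k, D.optCost Nc (VTOL.stateMap p (X (k + 1))) ≤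
          D.optCost Nc (VTOL.stateMap p (X k)) - D.stageCost (VTOL.stateMap p (X k)) (w k 0)) ∧
        (D.AvoidsObstacle (X 0) → ∀ k, D.AvoidsObstacle (X k)) ∧
        Tendsto X atTop (𝓝 (VTOL.hover p))) ∧
      -- Lyapunov stability of hover for the closed-loop UAV
      (∀ ε > 0, ∃ η > 0, ∀ (X : ℕ → VTOL.ExtState) (w : ℕ → ℕ → Fin 4 → ℝ),
        D.ClosedLoop p Nc X w → dist (X 0) (VTOL.hover p) < η →
        ∀ k, dist (X k) (VTOL.hover p) < ε) := by
  refine ⟨D.hasSum_stageCost hQ hR hK hLyap, ?_⟩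
  obtain ⟨N₀, hN₀⟩ := D.exists_terminalSet_invariant hδ hz hv hK
  refine ⟨N₀, fun Nc hNc hbar => ?_⟩
  have hinv := hN₀ Nc hNc
  have hstep := fun z v (h : D.IsOptimal Nc z v) => h.feasibleAt_step hN hv hLyap hinv hbar
  refine ⟨fun z => D.exists_isOptimal hv, hstep, fun X w hX h0 => ?_, fun ε hε =>
    D.closedLoop_stable p (fun U hU => D.linearLoop_stable hN hz hv hQ hR hK hLyap hinv hbar hU) hε⟩
  have hlin := hX.linearLoop
  have hf := hlin.feasibleAt hstep h0
  have hdec := hlin.optCost_succ_le hstep h0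
  refine ⟨hf, hdec, fun h k => ?_, ?_⟩
  · rw [← D.barrier_stateMap_nonneg_iff p] at h ⊢
    exact hlin.barrier_nonneg hN hγ' hf h k
  · exact VTOL.tendsto_hover_of_tendsto_stateMap p (Eventually.of_forall fun k => (hX k).1)
      (hlin.tendsto_zero hN hQ hR hK hLyap hf hdec)
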